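/- Let $X_1,X_2$ be two (possibly dependent) positive random variables on a common probability space such that, as $x\to\infty$, $$P(X_i>x)\sim g_i(x)\exp(-L_i x^{p_i}),\qquad i=1,2,$$ where $p_i,L_i>0$ are constants and $g_1,g_2$ are regularly varying at infinity (with indices $\alpha_1,\alpha_2\in\mathbb R$) and ultimately monotone; $a(x)\sim b(x)$ means $a(x)/b(x)\to1$. Put $$A=\Bigl(\frac{p_1L_1}{p_2L_2}\Bigr)^{\frac1{p_1+p_2}},\qquad B=L_1A^{-p_1}+L_2A^{p_2},\qquad w_x=x^{\frac{p_1}{p_1+p_2}},\qquad z_x=A\,w_x .$$ Suppose that there are a positive measurable function $c(\cdot,\cdot)$ and constants $K_1,K_2>0$, $\beta_1,\beta_2\in\mathbb R$ such that for all large $x$ $$P(X_1>x/y\mid X_2=y)=P(X_1>x/y)\,c(x,y)\quad\text{and}\quad K_1x^{\beta_1}\le c(x,y)\le K_2x^{\beta_2}\qquad\text{for all }y>0$$ (the first identity, as always with conditional probabilities, for almost every $y$ with respect to the law of $X_2$), and that for some constants $D>0$, $q_1,q_2\in\mathbb R$ and $0<a_1<A<a_2$ $$\lim_{x\to\infty}\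 \sup_{y\in[a_1w_x,\,a_2w_x]}\left|\frac{c(x,y)}{D\,x^{q_1}y^{q_2-q_1}}-1\right|=0 .$$ Then, as $x\to\infty$, $$P(X_1X_2>x)\sim D\Bigl(\frac{2\pi p_2L_2}{p_1+p_2}\Bigr)^{\frac12}A^{\frac{p_2}2+q_2-q_1}\,x^{\frac{2p_2q_1+2p_1q_2+p_1p_2}{2(p_1+p_2)}}\,g_1\!\left(\frac{x}{z_x}\right)g_2(z_x)\exp\Bigl(-B\,x^{\frac{p_1p_2}{p_1+p_2}}\Bigr).$$ -/

import Mathlib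

open MeasureTheory ProbabilityTheory Filter Set
open scoped Asymptotics Topology

/-- `g` is regularly varying at infinity with index `α`: it is positive and measurable on some
half-line `[X, ∞)`, and `g (t x) / g x → t ^ α` as `x → ∞` for every `t > 0`. -/
def IsRegularlyVarying (g : ℝ → ℝ) (α : ℝ) : Prop :=
  (∃ X : ℝ, Measurable (fun x : Ici X => g x) ∧ ∀ x ∈ Ici X, 0 < g x) ∧
    ∀ t : ℝ, 0 < t → Tendsto (fun x => g (t * x) / g x) atTop (𝓝 (t ^ α))

/-- `g` is ultimately monotone: on some half-line `[X, ∞)` it is nondecreasing, or it is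
nonincreasing. -/
def IsUltimatelyMonotone (g : ℝ → ℝ) : Prop :=
  ∃ X : ℝ, MonotoneOn g (Ici X) ∨ AntitoneOn g (Ici X)

/-- The random variable `X` has a Weibull-type tail:
`P(X > x) ∼ g x * exp (- L * x ^ p)` as `x → ∞`. -/
def HasWeibullTail {Ω : Type*} [MeasurableSpace Ω] (μ : Measure Ω) (X : Ω → ℝ)
    (g : ℝ → ℝ) (L p : ℝ) : Prop :=
  (fun x : ℝ => μ.real {ω | x < X ω}) ~[atTop] fun x : ℝ => g x * Real.exp (-L * x ^ p)

/-! Conditioning on `X₂ = y` writes the tail as `∫ P(X₁ > x/y) c(x, y) dP_{X₂}(y)`. Put `y = s w_x`,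
`V = x ^ (p₂ / (p₁ + p₂))` and `W = x ^ (p₁ p₂ / (p₁ + p₂))`. Since `w_x V = x`, the two tails are
taken at `V / s` and `s w_x`, and their exponents add up to `-W φ(s)` with `φ(s) = L₁ s ^ (-p₁) + L₂
s ^ p₂`. This `φ` has a strict global minimum at `A`, of value `B`, so the mass concentrates at `s =
A`.

Away from `A`, crude bounds suffice: regularly varying factors and powers of `x` are `exp(o(W))`, so
it is enough to compare limits of `log / W`, cell by cell over a compact set, with the two ends
treated separately (`tendsto_outside_window`).

Near `A`, monotonicity makes the regular variation locally uniform, so `g₁`, `g₂` and `c` may be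
frozen at `s = A` up to factors `1 ± δ`. What remains is `∫ exp(-W L₁ s ^ (-p₁))` against the law of
`X₂`, which need not have a density; only its tail is known. Integration by parts moves the integral
onto that tail and yields `W ∫ L₁ p₁ s ^ (-p₁ - 1) exp(-W φ(s)) ds` plus boundary terms that are
exponentially smaller (`integral_weibull_bounds`). Laplace's method contributes `√(π / (m W))` with
`m = φ''(A) / 2`; hence the factor `√W` in the answer (`exists_window_tail`). -/

/-! ### Monotone regularly varying functions and Weibull-type tails -/

theorem IsRegularlyVarying.eventually_pos {g : ℝ → ℝ} {α : ℝ} (hg : IsRegularlyVarying g α) :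
    ∀ᶠ x in atTop, 0 < g x := by
  obtain ⟨⟨X, -, hX⟩, -⟩ := hg
  filter_upwards [eventually_ge_atTop X] with x hx using hX x hx

theorem IsUltimatelyMonotone.exists_between {g : ℝ → ℝ} (hg : IsUltimatelyMonotone g) :
    ∃ X : ℝ, ∀ a b c : ℝ, X ≤ a → a ≤ b → b ≤ c →
      min (g a) (g c) ≤ g b ∧ g b ≤ max (g a) (g c) := by
  obtain ⟨X, h | h⟩ := hg
  · refine ⟨X, fun a b c ha hab hbc => ⟨min_le_of_left_le ?_, le_max_of_le_right ?_⟩⟩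
    · exact h ha (ha.trans hab) hab
    · exact h (ha.trans hab) ((ha.trans hab).trans hbc) hbc
  · refine ⟨X, fun a b c ha hab hbc => ⟨min_le_of_right_le ?_, le_max_of_le_left ?_⟩⟩
    · exact h (ha.trans hab) ((ha.trans hab).trans hbc) hbc
    · exact h ha (ha.trans hab) hab

/-- Monotonicity traps `g (t u)` between `g ((1 - r) u)` and `g ((1 + r) u)`, whose ratios to `g u`
tend to `(1 ± r) ^ α`. Taking `r` small gives uniformity in `t` from two pointwise limits. -/
theorem IsRegularlyVarying.tendsto_prod_one {g : ℝ → ℝ} {α : ℝ} (hg : IsRegularlyVarying g α)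
    (hmon : IsUltimatelyMonotone g) :
    Tendsto (fun p : ℝ × ℝ => g (p.2 * p.1) / g p.1) (atTop ×ˢ 𝓝 1) (𝓝 1) := by
  obtain ⟨X, hX⟩ := hmon.exists_between
  have key : ∀ ε : ℝ, 0 < ε → ∃ r : ℝ, 0 < r ∧ r < 1 ∧
      |(1 - r) ^ α - 1| < ε ∧ |(1 + r) ^ α - 1| < ε := by
    intro ε hε
    have h1 : Tendsto (fun r : ℝ => |(1 - r) ^ α - 1|) (𝓝 0) (𝓝 0) := by
      have : ContinuousAt (fun r : ℝ => |(1 - r) ^ α - 1|) 0 := by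
        have : ContinuousAt (fun r : ℝ => (1 - r) ^ α) 0 :=
          ContinuousAt.rpow_const (by fun_prop) (by simp)
        fun_prop
      simpa [ContinuousAt] using this
    have h2 : Tendsto (fun r : ℝ => |(1 + r) ^ α - 1|) (𝓝 0) (𝓝 0) := by
      have : ContinuousAt (fun r : ℝ => |(1 + r) ^ α - 1|) 0 := by
        have : ContinuousAt (fun r : ℝ => (1 + r) ^ α) 0 :=
          ContinuousAt.rpow_const (by fun_prop) (by simp)
        fun_prop
      simpa [ContinuousAt] using this
    have h3 := ((h1.eventually_lt_const hε).and (h2.eventually_lt_const hε)).filter_mono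
      (nhdsWithin_le_nhds (s := Ioi 0))
    have h4 : ∀ᶠ r : ℝ in 𝓝[>] 0, r ∈ Ioo (0 : ℝ) 1 := Ioo_mem_nhdsGT one_pos
    obtain ⟨r, hr, hr'⟩ := (h3.and h4).exists
    exact ⟨r, hr'.1, hr'.2, hr.1, hr.2⟩
  rw [Metric.tendsto_nhds]
  intro ε hε
  obtain ⟨r, hr0, hr1, hra, hrb⟩ := key ε hε
  have e1 := (((hg.2 (1 - r) (by linarith)).sub_const 1).abs).eventually_lt_const hra
  have e2 := (((hg.2 (1 + r) (by linarith)).sub_const 1).abs).eventually_lt_const hrb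
  have e3 := (tendsto_id.const_mul_atTop (show (0 : ℝ) < 1 - r by linarith)).eventually_ge_atTop X
  have hx := ((e1.and e2).and (e3.and (hg.eventually_pos.and (eventually_gt_atTop (0 : ℝ)))))
  have ht : ∀ᶠ t : ℝ in 𝓝 1, t ∈ Ioo (1 - r) (1 + r) :=
    Ioo_mem_nhds (by linarith) (by linarith)
  filter_upwards [hx.prod_mk ht] with ⟨u, t⟩ ⟨⟨⟨h1, h2⟩, h3, hgu, hu⟩, ht1, ht2⟩
  simp only [id] at *
  obtain ⟨hl, hu'⟩ := hX ((1 - r) * u) (t * u) ((1 + r) * u) h3 (by gcongr) (by gcongr)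
  rw [Real.dist_eq, abs_lt]
  rw [abs_lt] at h1 h2
  constructor
  · have : min (g ((1 - r) * u) / g u) (g ((1 + r) * u) / g u) ≤ g (t * u) / g u := by
      rw [min_div_div_right hgu.le]; gcongr
    rcases min_le_iff.1 this with h | h <;> linarith
  · have : g (t * u) / g u ≤ max (g ((1 - r) * u) / g u) (g ((1 + r) * u) / g u) := by
      rw [max_div_div_right hgu.le]; gcongr
    rcases le_max_iff.1 this with h | h <;> linarith

/-- Uniform convergence theorem for ultimately monotone regularly varying functions,
local at a point `A > 0`. -/
theorem IsRegularlyVarying.tendsto_prod {g : ℝ → ℝ} {α : ℝ} (hg : IsRegularlyVarying g α)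
    (hmon : IsUltimatelyMonotone g) {A : ℝ} (hA : 0 < A) :
    Tendsto (fun p : ℝ × ℝ => g (p.2 * p.1) / g (A * p.1)) (atTop ×ˢ 𝓝 A) (𝓝 1) := by
  have h1 : Tendsto (fun p : ℝ × ℝ => (A * p.1, p.2 / A)) (atTop ×ˢ 𝓝 A) (atTop ×ˢ 𝓝 1) := by
    refine Tendsto.prodMk (tendsto_fst.const_mul_atTop hA) ?_
    have := (tendsto_snd (f := (atTop : Filter ℝ)) (g := 𝓝 A)).div_const A
    rwa [div_self hA.ne'] at this
  refine ((hg.tendsto_prod_one hmon).comp h1).congr fun p => ?_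
  simp only [Function.comp]
  congr 2
  field_simp

/-- Doubling the argument changes `log g` by at most a constant `C`, while `K x ^ q` gains a factor
`2 ^ q`. The bound thus propagates dyadically from `[Y, 2Y]`, where monotonicity bounds `log g` by
its endpoint values. -/
theorem IsRegularlyVarying.exists_abs_log_le {g : ℝ → ℝ} {α : ℝ} (hg : IsRegularlyVarying g α)
    (hmon : IsUltimatelyMonotone g) {q : ℝ} (hq : 0 < q) :
    ∃ K : ℝ, ∀ᶠ x in atTop, |Real.log (g x)| ≤ K * x ^ q := by
  obtain ⟨X, hX⟩ := hmon.exists_between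
  have h2 : Tendsto (fun x => |Real.log (g (2 * x) / g x)|) atTop (𝓝 |Real.log (2 ^ α)|) :=
    ((hg.2 2 two_pos).log (by positivity)).abs
  set C : ℝ := |Real.log (2 ^ α)| + 1 with hC
  have hC0 : 0 < C := by positivity
  obtain ⟨Y, hY⟩ := eventually_atTop.1 ((h2.eventually_lt_const (lt_add_one _)).and
    (hg.eventually_pos.and ((eventually_ge_atTop X).and (eventually_ge_atTop 1))))
  have hY1 : 1 ≤ Y := (hY Y le_rfl).2.2.2
  have h2q : 1 < (2 : ℝ) ^ q := Real.one_lt_rpow one_lt_two hq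
  set m : ℝ := max |Real.log (g Y)| |Real.log (g (2 * Y))| with hm
  -- The first entry covers the base interval, the second absorbs the increment `C` at each
  -- doubling.
  set K : ℝ := max m (C / (2 ^ q - 1)) with hK
  have hKC : C ≤ K * (2 ^ q - 1) := by
    have : C / (2 ^ q - 1) ≤ K := le_max_right _ _
    rwa [div_le_iff₀ (by linarith)] at this
  have hK0 : 0 ≤ K := le_max_of_le_left (le_max_of_le_left (abs_nonneg _))
  have base : ∀ x, Y ≤ x → x ≤ 2 * Y → |Real.log (g x)| ≤ K * x ^ q := by
    intro x h1 h2
    have hx1 : 1 ≤ x ^ q := Real.one_le_rpow (hY1.trans h1) hq.le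
    have hgx := (hY x h1).2.1
    have hg1 := (hY Y le_rfl).2.1
    have hg2 := (hY (2 * Y) (by linarith)).2.1
    obtain ⟨hl, hu⟩ := hX Y x (2 * Y) (hY Y le_rfl).2.2.1 h1 h2
    have : |Real.log (g x)| ≤ m := by
      rw [abs_le]
      have a1 := abs_le.1 (le_max_left |Real.log (g Y)| |Real.log (g (2 * Y))|)
      have a2 := abs_le.1 (le_max_right |Real.log (g Y)| |Real.log (g (2 * Y))|)
      constructor
      · rcases min_le_iff.1 hl with h | h
        · have := Real.log_le_log hg1 h; linarith
        · have := Real.log_le_log hg2 h; linarith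
      · rcases le_max_iff.1 hu with h | h
        · have := Real.log_le_log hgx h; linarith
        · have := Real.log_le_log hgx h; linarith
    calc |Real.log (g x)| ≤ K := this.trans (le_max_left _ _)
      _ ≤ K * x ^ q := le_mul_of_one_le_right hK0 hx1
  have step : ∀ n : ℕ, ∀ x, Y ≤ x → x ≤ 2 ^ (n + 1) * Y → |Real.log (g x)| ≤ K * x ^ q := by
    intro n
    induction n with
    | zero => intro x h1 h2; exact base x h1 (by simpa using h2)
    | succ n ih =>
      intro x h1 h2
      rcases le_total x (2 * Y) with h | h
      · exact base x h1 h
      have hx2 : Y ≤ x / 2 := by linarith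
      have i1 := ih (x / 2) hx2 (by rw [pow_succ] at h2; linarith)
      have i2 := (hY (x / 2) hx2).1
      have hp1 := (hY (x / 2) hx2).2.1
      have hp2 := (hY x h1).2.1
      rw [show 2 * (x / 2) = x by ring, Real.log_div hp2.ne' hp1.ne'] at i2
      have hxq : x ^ q = 2 ^ q * (x / 2) ^ q := by
        rw [← Real.mul_rpow two_pos.le (by linarith)]; congr 1; ring
      have h1q : 1 ≤ (x / 2) ^ q := Real.one_le_rpow (hY1.trans hx2) hq.le
      have i3 : |Real.log (g x)| ≤ |Real.log (g (x / 2))| + C := by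
        have := abs_sub_abs_le_abs_sub (Real.log (g x)) (Real.log (g (x / 2)))
        linarith
      have i4 : C ≤ K * (2 ^ q - 1) * (x / 2) ^ q :=
        hKC.trans (le_mul_of_one_le_right (hC0.le.trans hKC) h1q)
      rw [hxq]
      linarith
  refine ⟨K, ?_⟩
  filter_upwards [eventually_ge_atTop Y] with x hx
  obtain ⟨n, hn⟩ := pow_unbounded_of_one_lt (x / Y) (one_lt_two : (1 : ℝ) < 2)
  refine step n x hx ?_
  rw [div_lt_iff₀ (by linarith)] at hn
  rw [pow_succ]
  nlinarith [pow_pos (two_pos : (0 : ℝ) < 2) n]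

theorem IsRegularlyVarying.tendsto_log_div_rpow {g : ℝ → ℝ} {α : ℝ} (hg : IsRegularlyVarying g α)
    (hmon : IsUltimatelyMonotone g) {p : ℝ} (hp : 0 < p) :
    Tendsto (fun x => Real.log (g x) / x ^ p) atTop (𝓝 0) := by
  obtain ⟨K, hK⟩ := hg.exists_abs_log_le hmon (half_pos hp)
  have h0 : Tendsto (fun x : ℝ => K * x ^ (-(p / 2))) atTop (𝓝 0) := by
    simpa using (tendsto_rpow_neg_atTop (half_pos hp)).const_mul K
  refine squeeze_zero_norm' ?_ h0
  filter_upwards [hK, eventually_gt_atTop 0] with x hx hx0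
  rw [Real.norm_eq_abs, abs_div, abs_of_pos (Real.rpow_pos_of_pos hx0 p),
    div_le_iff₀ (Real.rpow_pos_of_pos hx0 p), mul_assoc, ← Real.rpow_add hx0,
    show -(p / 2) + p = p / 2 by ring]
  exact hx

/-- On the logarithmic scale the ratio in `~` contributes `o(1)` and `g` contributes `o(x ^ p)`.
This weak form of the tail hypothesis is all that is needed away from the critical scale. -/
theorem tendsto_log_div_of_isEquivalent {f g : ℝ → ℝ} {L p : ℝ} (hp : 0 < p)
    (hg : ∀ᶠ x in atTop, 0 < g x)
    (hlog : Tendsto (fun x => Real.log (g x) / x ^ p) atTop (𝓝 0))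
    (hf : f ~[atTop] fun x : ℝ => g x * Real.exp (-L * x ^ p)) :
    (∀ᶠ x in atTop, 0 < f x) ∧ Tendsto (fun x => Real.log (f x) / x ^ p) atTop (𝓝 (-L)) := by
  have hne : ∀ᶠ x in atTop, g x * Real.exp (-L * x ^ p) ≠ 0 := by
    filter_upwards [hg] with x hx using by positivity
  have h1 := (Asymptotics.isEquivalent_iff_tendsto_one hne).1 hf
  have hpos : ∀ᶠ x in atTop, 0 < f x := by
    filter_upwards [h1.eventually_const_lt one_pos, hg] with x hx hgx
    simp only [Pi.div_apply] at hx
    exact (div_pos_iff_of_pos_right (by positivity)).1 hx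
  refine ⟨hpos, ?_⟩
  have h2 := h1.log one_ne_zero
  have h3 : Tendsto (fun x => Real.log (f x / (g x * Real.exp (-L * x ^ p))) / x ^ p)
      atTop (𝓝 0) := h2.div_atTop (tendsto_rpow_atTop hp)
  have h4 := (h3.add hlog).add_const (-L)
  simp only [zero_add] at h4
  refine h4.congr' ?_
  filter_upwards [hpos, hg, eventually_gt_atTop 0] with x hfx hgx hx
  have hxp := Real.rpow_pos_of_pos hx p
  rw [Real.log_div hfx.ne' (by positivity), Real.log_mul hgx.ne' (by positivity), Real.log_exp]
  field_simp
  ring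

/-- Local uniformity of the tail asymptotics in the scale of a window around `A u`. -/
theorem tendsto_tail_prod {f g : ℝ → ℝ} {L p α A : ℝ} (hA : 0 < A)
    (hg : IsRegularlyVarying g α) (hmon : IsUltimatelyMonotone g)
    (hf : f ~[atTop] fun x : ℝ => g x * Real.exp (-L * x ^ p)) :
    Tendsto (fun q : ℝ × ℝ => f (q.2 * q.1) / (g (A * q.1) * Real.exp (-L * (q.2 * q.1) ^ p)))
      (atTop ×ˢ 𝓝 A) (𝓝 1) := by
  have hne : ∀ᶠ x in atTop, g x * Real.exp (-L * x ^ p) ≠ 0 := by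
    filter_upwards [hg.eventually_pos] with x hx using by positivity
  have h1 := (Asymptotics.isEquivalent_iff_tendsto_one hne).1 hf
  have hm : Tendsto (fun q : ℝ × ℝ => q.2 * q.1) (atTop ×ˢ 𝓝 A) atTop :=
    Tendsto.pos_mul_atTop hA tendsto_snd tendsto_fst
  have h2 := (h1.comp hm).mul (hg.tendsto_prod hmon hA)
  rw [one_mul] at h2
  refine h2.congr' ?_
  filter_upwards [hm.eventually hg.eventually_pos] with q hq
  simp only [Function.comp, Pi.div_apply]
  field_simp

/-! ### Laplace's method -/

/-- Laplace's method at an interior quadratic minimum. -/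
theorem tendsto_laplace_integral {φ k : ℝ → ℝ} {a b A m : ℝ} (haA : a < A) (hAb : A < b)
    (hm : 0 < m) (hφm : Measurable φ) (hkm : Measurable k) (hk : ContinuousOn k (Icc a b))
    (hquad : ∀ s ∈ Icc a b, m / 2 * (s - A) ^ 2 ≤ φ s - φ A)
    (hlim : Tendsto (fun s => (φ s - φ A) / (s - A) ^ 2) (𝓝[≠] A) (𝓝 m)) :
    Tendsto (fun W : ℝ => √W * Real.exp (W * φ A) * ∫ s in a..b, k s * Real.exp (-W * φ s))
      atTop (𝓝 (k A * √(Real.pi / m))) := by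
  obtain ⟨C, hC⟩ := isCompact_Icc.exists_bound_of_continuousOn hk
  have hC0 : 0 ≤ C := (norm_nonneg _).trans (hC A ⟨haA.le, hAb.le⟩)
  set F : ℝ → ℝ → ℝ := fun W =>
    (Ioc a b).indicator fun s => k s * Real.exp (-W * (φ s - φ A)) with hF
  -- The substitution `s = A + t / √W` puts the integral on a fixed scale, where the integrand
  -- converges to a Gaussian.
  have hrew : ∀ᶠ W : ℝ in atTop, ∫ t, F W (A + (√W)⁻¹ * t) =
      √W * Real.exp (W * φ A) * ∫ s in a..b, k s * Real.exp (-W * φ s) := by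
    filter_upwards [eventually_gt_atTop 0] with W hW
    have hsq : 0 < √W := Real.sqrt_pos.2 hW
    rw [Measure.integral_comp_mul_left (fun u => F W (A + u)) (√W)⁻¹,
      integral_add_left_eq_self (F W) A, inv_inv, abs_of_pos hsq, smul_eq_mul, mul_assoc]
    congr 1
    rw [hF, integral_indicator measurableSet_Ioc,
      intervalIntegral.integral_of_le (haA.trans hAb).le, ← integral_const_mul]
    congr 1
    ext s
    rw [show -W * (φ s - φ A) = W * φ A + -W * φ s by ring, Real.exp_add]
    ring
  have hgauss : ∫ t : ℝ, k A * Real.exp (-m * t ^ 2) = k A * √(Real.pi / m) := by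
    rw [integral_const_mul, integral_gaussian]
  rw [← hgauss]
  refine Tendsto.congr' hrew ?_
  -- The quadratic lower bound, with half the limiting constant, provides the Gaussian majorant.
  refine tendsto_integral_filter_of_dominated_convergence
    (fun t => C * Real.exp (-(m / 2) * t ^ 2)) ?_ ?_ ?_ ?_
  · refine Eventually.of_forall fun W => ?_
    have : Measurable (F W) := Measurable.indicator (by fun_prop) measurableSet_Ioc
    exact (this.comp (by fun_prop)).aestronglyMeasurable
  · filter_upwards [eventually_gt_atTop 0] with W hW
    refine Eventually.of_forall fun t => ?_
    by_cases hs : A + (√W)⁻¹ * t ∈ Ioc a b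
    · simp only [hF]
      rw [indicator_of_mem hs, norm_mul, Real.norm_eq_abs (Real.exp _), Real.abs_exp]
      refine mul_le_mul (hC _ (Ioc_subset_Icc_self hs)) (Real.exp_le_exp.2 ?_)
        (Real.exp_pos _).le hC0
      have h1 := hquad _ (Ioc_subset_Icc_self hs)
      have h2 := mul_le_mul_of_nonneg_left h1 hW.le
      have h3 : W * (m / 2 * (A + (√W)⁻¹ * t - A) ^ 2) = m / 2 * t ^ 2 := by
        rw [add_sub_cancel_left, mul_pow, inv_pow, Real.sq_sqrt hW.le]
        field_simp
      linarith
    · simp only [hF]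
      rw [indicator_of_notMem hs, norm_zero]
      positivity
  · exact (integrable_exp_neg_mul_sq (half_pos hm)).const_mul C
  · refine Eventually.of_forall fun t => ?_
    have hs : Tendsto (fun W : ℝ => A + (√W)⁻¹ * t) atTop (𝓝 A) := by
      have : Tendsto (fun W : ℝ => (√W)⁻¹) atTop (𝓝 0) :=
        tendsto_inv_atTop_zero.comp Real.tendsto_sqrt_atTop
      simpa using (this.mul_const t).const_add A
    have hmem : ∀ᶠ W : ℝ in atTop, A + (√W)⁻¹ * t ∈ Ioc a b :=
      hs.eventually (Ioc_mem_nhds haA hAb)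
    have hkt : Tendsto (fun W : ℝ => k (A + (√W)⁻¹ * t)) atTop (𝓝 (k A)) :=
      ((hk.continuousAt (Icc_mem_nhds haA hAb)).tendsto).comp hs
    have hexp : Tendsto (fun W : ℝ => -W * (φ (A + (√W)⁻¹ * t) - φ A)) atTop
        (𝓝 (-m * t ^ 2)) := by
      -- `hlim` is a punctured limit, so `t = 0` is separate.
      rcases eq_or_ne t 0 with rfl | ht
      · simp
      have hs' : Tendsto (fun W : ℝ => A + (√W)⁻¹ * t) atTop (𝓝[≠] A) := by
        refine tendsto_nhdsWithin_iff.2 ⟨hs, ?_⟩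
        filter_upwards [eventually_gt_atTop 0] with W hW
        have : (√W)⁻¹ * t ≠ 0 := mul_ne_zero (inv_pos.2 (Real.sqrt_pos.2 hW)).ne' ht
        simpa using this
      have h1 := ((hlim.comp hs').neg).mul_const (t ^ 2)
      refine h1.congr' ?_
      filter_upwards [eventually_gt_atTop 0] with W hW
      simp only [Function.comp, add_sub_cancel_left, mul_pow, inv_pow, Real.sq_sqrt hW.le]
      field_simp
    refine (hkt.mul hexp.rexp).congr' ?_
    filter_upwards [hmem] with W hW
    simp only [hF]
    rw [indicator_of_mem hW]

/-! ### Integration by parts against a tail -/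

/-- Integration by parts against the tail function of a finite measure. -/
theorem setIntegral_Ioc_eq_integral_tail {ν : Measure ℝ} [IsFiniteMeasure ν] {a b : ℝ}
    (hab : a ≤ b) {h h' : ℝ → ℝ} (hd : ∀ s ∈ Icc a b, HasDerivAt h (h' s) s)
    (hc : ContinuousOn h' (Icc a b)) :
    ∫ s in Ioc a b, h s ∂ν = h a * ν.real (Ioi a) - h b * ν.real (Ioi b)
      + ∫ s in a..b, h' s * ν.real (Ioi s) := by
  obtain ⟨C, hC⟩ := isCompact_Icc.exists_bound_of_continuousOn hc
  have htail : ∀ s ∈ Icc a b, ν.real (Ioc s b) = ν.real (Ioi s) - ν.real (Ioi b) := by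
    intro s hs
    rw [← Ioi_sdiff_Ioi, measureReal_sdiff (Ioi_subset_Ioi hs.2) measurableSet_Ioi]
  have hint : ∀ y ∈ Icc a b, ∫ s in a..y, h' s = h y - h a := by
    intro y hy
    refine intervalIntegral.integral_eq_sub_of_hasDerivAt (fun s hs => hd s ?_) ?_
    · rw [uIcc_of_le hy.1] at hs
      exact ⟨hs.1, hs.2.trans hy.2⟩
    · refine (hc.mono ?_).intervalIntegrable
      rw [uIcc_of_le hy.1]
      exact Icc_subset_Icc_right hy.2
  have hm' : AEStronglyMeasurable h' (volume.restrict (Ioc a b)) :=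
    (hc.mono Ioc_subset_Icc_self).aestronglyMeasurable measurableSet_Ioc
  -- Fubini for `h' s` on the triangle `s < y`: integrating in `s` first gives `h y - h a`, in `y`
  -- first gives the tail increment `ν (s, b]`.
  set f : ℝ × ℝ → ℝ := {p : ℝ × ℝ | p.2 < p.1}.indicator (fun p => h' p.2) with hf
  have hfm : AEStronglyMeasurable f ((ν.restrict (Ioc a b)).prod (volume.restrict (Ioc a b))) :=
    (hm'.comp_snd).indicator (measurableSet_lt measurable_snd measurable_fst)
  have hfi : Integrable f ((ν.restrict (Ioc a b)).prod (volume.restrict (Ioc a b))) := by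
    refine Integrable.of_bound hfm C ?_
    rw [Measure.prod_restrict]
    refine (ae_restrict_iff' (measurableSet_Ioc.prod measurableSet_Ioc)).2
      (Eventually.of_forall fun p hp => ?_)
    refine (norm_indicator_le_norm_self _ _).trans (hC _ (Ioc_subset_Icc_self hp.2))
  have hswap := integral_integral_swap (f := fun y s => f (y, s)) hfi
  have hl : ∫ y in Ioc a b, (∫ s in Ioc a b, f (y, s)) ∂ν = ∫ y in Ioc a b, (h y - h a) ∂ν := by
    refine setIntegral_congr_fun measurableSet_Ioc fun y hy => ?_
    have e : (fun s => f (y, s)) = (Iio y).indicator h' := by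
      ext s; simp [hf, indicator_apply]
    have e2 : Ioc a b ∩ Iio y = Ioo a y := by
      ext s
      simp only [mem_inter_iff, mem_Ioc, mem_Iio, mem_Ioo]
      exact ⟨fun h => ⟨h.1.1, h.2⟩, fun h => ⟨⟨h.1, h.2.le.trans hy.2⟩, h.2⟩⟩
    simp only [e]
    rw [setIntegral_indicator measurableSet_Iio, e2, ← integral_Ioc_eq_integral_Ioo,
      ← intervalIntegral.integral_of_le hy.1.le, hint y (Ioc_subset_Icc_self hy)]
  have hr : ∫ s in Ioc a b, (∫ y in Ioc a b, f (y, s) ∂ν)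
      = ∫ s in Ioc a b, (h' s * ν.real (Ioi s) - h' s * ν.real (Ioi b)) := by
    refine setIntegral_congr_fun measurableSet_Ioc fun s hs => ?_
    have e : (fun y => f (y, s)) = (Ioi s).indicator (fun _ => h' s) := by
      ext y; simp [hf, indicator_apply]
    have e2 : Ioc a b ∩ Ioi s = Ioc s b := by
      ext y
      simp only [mem_inter_iff, mem_Ioc, mem_Ioi]
      exact ⟨fun h => ⟨h.2, h.1.2⟩, fun h => ⟨⟨hs.1.trans h.1, h.2⟩, h.1⟩⟩
    simp only [e]
    rw [setIntegral_indicator measurableSet_Ioi, e2, setIntegral_const, smul_eq_mul,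
      htail s (Ioc_subset_Icc_self hs)]
    ring
  have hh : IntegrableOn h (Ioc a b) ν :=
    (ContinuousOn.integrableOn_Icc fun s hs => (hd s hs).continuousAt.continuousWithinAt).mono_set
      Ioc_subset_Icc_self
  have hh' : IntegrableOn h' (Ioc a b) := hc.integrableOn_Icc.mono_set Ioc_subset_Icc_self
  have hanti : Antitone fun s => ν.real (Ioi s) := fun s t hst =>
    measureReal_mono (Ioi_subset_Ioi hst)
  have hht : IntegrableOn (fun s => h' s * ν.real (Ioi s)) (Ioc a b) := by
    refine Integrable.mul_bdd (c := ν.real univ) hh' hanti.measurable.aestronglyMeasurable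
      (Eventually.of_forall fun s => ?_)
    rw [Real.norm_of_nonneg measureReal_nonneg]
    exact measureReal_mono (subset_univ _)
  rw [hl, hr, integral_sub hh (integrable_const _), integral_sub hht (hh'.mul_const _),
    setIntegral_const, smul_eq_mul, integral_mul_const,
    ← intervalIntegral.integral_of_le (μ := volume) hab,
    ← intervalIntegral.integral_of_le (μ := volume) hab, hint b ⟨hab, le_rfl⟩, htail a ⟨le_rfl, hab⟩] at hswap
  linear_combination hswap

/-- Integration by parts against the tail function of a finite measure, in a scaled variable. -/
theorem setIntegral_Ioc_comp_div_eq_integral_tail {ν : Measure ℝ} [IsFiniteMeasure ν]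
    {a b w : ℝ} (hab : a ≤ b) (hw : 0 < w) {h h' : ℝ → ℝ}
    (hd : ∀ s ∈ Icc a b, HasDerivAt h (h' s) s) (hc : ContinuousOn h' (Icc a b))
    (hm : Measurable h) :
    ∫ y in Ioc (a * w) (b * w), h (y / w) ∂ν = h a * ν.real (Ioi (a * w))
      - h b * ν.real (Ioi (b * w)) + ∫ s in a..b, h' s * ν.real (Ioi (s * w)) := by
  have hmw : Measurable fun y : ℝ => y / w := by fun_prop
  have hr : ∀ s, (ν.map fun y => y / w).real (Ioi s) = ν.real (Ioi (s * w)) := by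
    intro s
    rw [map_measureReal_apply hmw measurableSet_Ioi]
    congr 1
    ext y
    simp [lt_div_iff₀ hw]
  have hpre : (fun y : ℝ => y / w) ⁻¹' Ioc a b = Ioc (a * w) (b * w) := by
    ext y
    simp [lt_div_iff₀ hw, div_le_iff₀ hw]
  have := setIntegral_Ioc_eq_integral_tail (ν := ν.map fun y => y / w) hab hd hc
  rw [setIntegral_map measurableSet_Ioc hm.aestronglyMeasurable hmw.aemeasurable, hpre] at this
  simpa only [hr] using this

/-! ### Disintegration along the second factor -/

section Conditioning

variable {Ω : Type*} [MeasurableSpace Ω] {μ : Measure Ω} [IsProbabilityMeasure μ] {X₁ X₂ : Ω → ℝ}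

/-- Disintegration of the tail of a product along the second factor. -/
theorem measureReal_mul_tail_inter (hX₁ : Measurable X₁) (hX₂ : Measurable X₂) {x : ℝ}
    {k : ℝ → ℝ} {T : Set ℝ} (hT : MeasurableSet T) (hT0 : T ⊆ Ioi 0)
    (hcond : ∀ᵐ y ∂(μ.map X₂), (condDistrib X₁ X₂ μ y).real (Ioi (x / y)) = k y) :
    IntegrableOn k T (μ.map X₂) ∧
      μ.real {ω | x < X₁ ω * X₂ ω ∧ X₂ ω ∈ T} = ∫ y in T, k y ∂(μ.map X₂) := by
  have : IsProbabilityMeasure (μ.map X₂) := Measure.isProbabilityMeasure_map hX₂.aemeasurable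
  set κ := condDistrib X₁ X₂ μ
  have hs0 : MeasurableSet {p : ℝ × ℝ | x / p.1 < p.2} :=
    measurableSet_lt (by fun_prop) measurable_snd
  have hs : MeasurableSet {p : ℝ × ℝ | x < p.2 * p.1 ∧ p.1 ∈ T} :=
    (measurableSet_lt measurable_const (measurable_snd.mul measurable_fst)).inter
      (measurable_fst hT)
  have hm : Measurable fun y => κ y (Ioi (x / y)) := Kernel.measurable_kernel_prodMk_left hs0
  have hint : IntegrableOn (fun y => (κ y).real (Ioi (x / y))) T (μ.map X₂) :=
    Integrable.of_bound hm.ennreal_toReal.aestronglyMeasurable 1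
      (Eventually.of_forall fun y => by
        rw [Real.norm_of_nonneg measureReal_nonneg]
        exact measureReal_le_one)
  refine ⟨hint.congr (ae_restrict_of_ae hcond), ?_⟩
  rw [← integral_congr_ae (ae_restrict_of_ae hcond)]
  have h1 : μ {ω | x < X₁ ω * X₂ ω ∧ X₂ ω ∈ T} =
      ((μ.map X₂) ⊗ₘ κ) {p : ℝ × ℝ | x < p.2 * p.1 ∧ p.1 ∈ T} := by
    rw [compProd_map_condDistrib hX₁.aemeasurable, Measure.map_apply (hX₂.prodMk hX₁) hs]
    rfl
  have h2 : (fun y => κ y (Prod.mk y ⁻¹' {p : ℝ × ℝ | x < p.2 * p.1 ∧ p.1 ∈ T})) =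
      T.indicator fun y => κ y (Ioi (x / y)) := by
    ext y
    by_cases hy : y ∈ T
    · rw [indicator_of_mem hy]
      congr 1
      ext u
      simp [hy, div_lt_iff₀ (show 0 < y from hT0 hy)]
    · rw [indicator_of_notMem hy]
      simp [hy]
  rw [measureReal_def, h1, Measure.compProd_apply hs, h2, lintegral_indicator hT]
  exact (integral_toReal hm.aemeasurable (Eventually.of_forall fun y => measure_lt_top _ _)).symm

/-- `P(X₁ > x/y)` increases with `y`, so on `(0, v]` it is at most its value at `v`. -/
theorem measureReal_mul_tail_inter_le (hX₁ : Measurable X₁) (hX₂ : Measurable X₂) {x C v : ℝ}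
    (hx : 0 ≤ x) (hC : 0 ≤ C) {c : ℝ → ℝ} {T : Set ℝ} (hT : MeasurableSet T) (hT0 : T ⊆ Ioc 0 v)
    (hcond : ∀ᵐ y ∂(μ.map X₂), (condDistrib X₁ X₂ μ y).real (Ioi (x / y)) =
      μ.real {ω | x / y < X₁ ω} * c y) (hc : ∀ y, 0 < y → c y ≤ C) :
    μ.real {ω | x < X₁ ω * X₂ ω ∧ X₂ ω ∈ T} ≤
      C * μ.real {ω | x / v < X₁ ω} * (μ.map X₂).real T := by
  have : IsProbabilityMeasure (μ.map X₂) := Measure.isProbabilityMeasure_map hX₂.aemeasurable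
  obtain ⟨hi, he⟩ := measureReal_mul_tail_inter hX₁ hX₂ hT (fun y hy => (hT0 hy).1) hcond
  rw [he]
  calc _ ≤ ∫ y in T, C * μ.real {ω | x / v < X₁ ω} ∂(μ.map X₂) := by
        refine setIntegral_mono_on hi integrableOn_const hT fun y hy => ?_
        have hy' := hT0 hy
        rw [mul_comm C]
        refine mul_le_mul_of_nonneg_left (hc y hy'.1) measureReal_nonneg |>.trans ?_
        refine mul_le_mul_of_nonneg_right (measureReal_mono fun ω hω => ?_) hC
        exact (div_le_div_of_nonneg_left hx hy'.1 hy'.2).trans_lt hω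
    _ = _ := by rw [setIntegral_const, smul_eq_mul, mul_comm]

end Conditioning

/-! ### Comparison on the logarithmic scale -/

/-- The quotient is `exp` of `W` times a quantity tending to `a - b < 0`. -/
theorem tendsto_div_zero_of_log {f M W : ℝ → ℝ} {a b : ℝ} (hW : Tendsto W atTop atTop)
    (hf : ∀ᶠ x in atTop, 0 < f x) (hM : ∀ᶠ x in atTop, 0 < M x)
    (lf : Tendsto (fun x => Real.log (f x) / W x) atTop (𝓝 a))
    (lM : Tendsto (fun x => Real.log (M x) / W x) atTop (𝓝 b)) (hab : a < b) :
    Tendsto (fun x => f x / M x) atTop (𝓝 0) := by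
  have h1 := Real.tendsto_exp_atBot.comp ((lf.sub lM).neg_mul_atTop (by linarith) hW)
  refine h1.congr' ?_
  filter_upwards [hf, hM, hW.eventually_gt_atTop 0] with x hfx hMx hWx
  simp only [Function.comp]
  rw [← sub_div, div_mul_cancel₀ _ hWx.ne', ← Real.log_div hfx.ne' hMx.ne',
    Real.exp_log (by positivity)]

/-- Brings both tails to the common scale `W`: it is used with `ρ = V`, `p = p₁` and with `ρ = w`,
`p = p₂`. -/
theorem tendsto_log_comp_div {F ρ W : ℝ → ℝ} {l p σ : ℝ} (hσ : 0 < σ)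
    (hF : Tendsto (fun u => Real.log (F u) / u ^ p) atTop (𝓝 l))
    (hρ : Tendsto ρ atTop atTop) (hρW : ∀ᶠ x in atTop, ρ x ^ p = W x) :
    Tendsto (fun x => Real.log (F (σ * ρ x)) / W x) atTop (𝓝 (l * σ ^ p)) := by
  have h1 := (hF.comp (hρ.const_mul_atTop hσ)).mul_const (σ ^ p)
  refine h1.congr' ?_
  filter_upwards [hρW, hρ.eventually_gt_atTop 0] with x hx hρ0
  have := Real.rpow_pos_of_pos hρ0 p
  have := Real.rpow_pos_of_pos hσ p
  simp only [Function.comp]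
  rw [Real.mul_rpow hσ.le hρ0.le, ← hx]
  field_simp

theorem tendsto_log_const_mul_rpow_div {C β r : ℝ} (hC : 0 < C) (hr : 0 < r) :
    Tendsto (fun x : ℝ => Real.log (C * x ^ β) / x ^ r) atTop (𝓝 0) := by
  have h1 : Tendsto (fun x : ℝ => Real.log x / x ^ r) atTop (𝓝 0) :=
    (isLittleO_log_rpow_atTop hr).tendsto_div_nhds_zero
  have h2 : Tendsto (fun x : ℝ => Real.log C / x ^ r) atTop (𝓝 0) :=
    tendsto_const_nhds.div_atTop (tendsto_rpow_atTop hr)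
  have h3 := h2.add (h1.const_mul β)
  rw [mul_zero, add_zero] at h3
  refine h3.congr' ?_
  filter_upwards [eventually_gt_atTop 0] with x hx
  rw [Real.log_mul hC.ne' (Real.rpow_pos_of_pos hx β).ne', Real.log_rpow hx]
  ring

/-! ### The exponent and its minimum -/

/-- The exponent `s ↦ L₁ s ^ (-p₁) + L₂ s ^ p₂` whose minimum governs the tail of the product. -/
noncomputable def productExponent (L₁ p₁ L₂ p₂ s : ℝ) : ℝ := L₁ * s ^ (-p₁) + L₂ * s ^ p₂

section Exponent

variable {L₁ p₁ L₂ p₂ A : ℝ}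

theorem measurable_productExponent : Measurable (productExponent L₁ p₁ L₂ p₂) := by
  unfold productExponent
  fun_prop

theorem continuousAt_productExponent {s : ℝ} (hs : 0 < s) :
    ContinuousAt (productExponent L₁ p₁ L₂ p₂) s := by
  unfold productExponent
  exact ((Real.continuousAt_rpow_const s _ (Or.inl hs.ne')).const_mul L₁).add
    ((Real.continuousAt_rpow_const s _ (Or.inl hs.ne')).const_mul L₂)

theorem hasDerivAt_productExponent {s : ℝ} (hs : 0 < s) :
    HasDerivAt (productExponent L₁ p₁ L₂ p₂)
      (s ^ (-p₁ - 1) * (L₂ * p₂ * s ^ (p₁ + p₂) - p₁ * L₁)) s := by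
  have h1 := (Real.hasDerivAt_rpow_const (p := -p₁) (Or.inl hs.ne')).const_mul L₁
  have h2 := (Real.hasDerivAt_rpow_const (p := p₂) (Or.inl hs.ne')).const_mul L₂
  refine (h1.add h2).congr_deriv ?_
  have h3 : s ^ (p₂ - 1) = s ^ (-p₁ - 1) * s ^ (p₁ + p₂) := by
    rw [← Real.rpow_add hs]; congr 1; ring
  rw [h3]
  ring

/-- In the factored derivative, the bracket is increasing in `s` and vanishes at `A`; so the
exponent decreases up to `A` and increases after it. -/
theorem productExponent_lt (hp : 0 < p₁ + p₂) (hLp : 0 < L₂ * p₂) (hA0 : 0 < A)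
    (hA : L₂ * p₂ * A ^ (p₁ + p₂) = p₁ * L₁) {s : ℝ} (hs : 0 < s) (hsA : s ≠ A) :
    productExponent L₁ p₁ L₂ p₂ A < productExponent L₁ p₁ L₂ p₂ s := by
  rcases hsA.lt_or_gt with h | h
  · have : StrictAntiOn (productExponent L₁ p₁ L₂ p₂) (Ioc 0 A) := by
      refine strictAntiOn_of_deriv_neg (convex_Ioc 0 A)
        (fun t ht => (continuousAt_productExponent ht.1).continuousWithinAt) fun t ht => ?_
      rw [interior_Ioc] at ht
      rw [(hasDerivAt_productExponent ht.1).deriv, ← hA, ← mul_sub]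
      have h1 := Real.rpow_lt_rpow ht.1.le ht.2 hp
      exact mul_neg_of_pos_of_neg (Real.rpow_pos_of_pos ht.1 _)
        (mul_neg_of_pos_of_neg hLp (by linarith))
    exact this ⟨hs, h.le⟩ ⟨hA0, le_rfl⟩ h
  · have : StrictMonoOn (productExponent L₁ p₁ L₂ p₂) (Ici A) := by
      refine strictMonoOn_of_deriv_pos (convex_Ici A)
        (fun t ht => (continuousAt_productExponent (hA0.trans_le ht)).continuousWithinAt)
        fun t ht => ?_
      rw [interior_Ici] at ht
      have ht0 : 0 < t := hA0.trans ht
      rw [(hasDerivAt_productExponent ht0).deriv, ← hA, ← mul_sub]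
      have h1 := Real.rpow_lt_rpow hA0.le ht hp
      exact mul_pos (Real.rpow_pos_of_pos ht0 _) (mul_pos hLp (by linarith))
    exact this (mem_Ici.2 le_rfl) (mem_Ici.2 h.le) h

/-- The limit is half the second derivative. One application of L'Hôpital leaves half the difference
quotient of `f'` at `A`, since `f' A = 0`. -/
theorem tendsto_productExponent_sub_div_sq (hA0 : 0 < A)
    (hA : L₂ * p₂ * A ^ (p₁ + p₂) = p₁ * L₁) :
    Tendsto (fun s => (productExponent L₁ p₁ L₂ p₂ s - productExponent L₁ p₁ L₂ p₂ A)
      / (s - A) ^ 2) (𝓝[≠] A) (𝓝 (L₂ * p₂ * (p₁ + p₂) * A ^ (p₂ - 2) / 2)) := by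
  set f' : ℝ → ℝ := fun s => s ^ (-p₁ - 1) * (L₂ * p₂ * s ^ (p₁ + p₂) - p₁ * L₁) with hf'
  have hfA : f' A = 0 := by simp [hf', hA]
  have hd : HasDerivAt f' (L₂ * p₂ * (p₁ + p₂) * A ^ (p₂ - 2)) A := by
    have h1 := Real.hasDerivAt_rpow_const (x := A) (p := -p₁ - 1) (Or.inl hA0.ne')
    have h2 := ((Real.hasDerivAt_rpow_const (x := A) (p := p₁ + p₂)
      (Or.inl hA0.ne')).const_mul (L₂ * p₂)).sub_const (p₁ * L₁)
    refine (h1.mul h2).congr_deriv ?_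
    have h3 : A ^ (p₂ - 2) = A ^ (-p₁ - 1) * A ^ (p₁ + p₂ - 1) := by
      rw [← Real.rpow_add hA0]; congr 1; ring
    rw [h3, hA]
    ring
  have hpos : ∀ᶠ s in 𝓝[≠] A, 0 < s := (lt_mem_nhds hA0).filter_mono nhdsWithin_le_nhds
  have hc : ContinuousAt (fun s => productExponent L₁ p₁ L₂ p₂ s
      - productExponent L₁ p₁ L₂ p₂ A) A :=
    (continuousAt_productExponent hA0).sub continuousAt_const
  refine HasDerivAt.lhopital_zero_nhdsNE (f' := f') (g' := fun s => 2 * (s - A)) ?_ ?_ ?_ ?_ ?_ ?_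
  · filter_upwards [hpos] with s hs using (hasDerivAt_productExponent hs).sub_const _
  · refine Eventually.of_forall fun s => ?_
    simpa using ((hasDerivAt_id s).sub_const A).fun_pow 2
  · filter_upwards [self_mem_nhdsWithin] with s hs
    exact mul_ne_zero two_ne_zero (sub_ne_zero.2 hs)
  · have := hc.tendsto.mono_left (nhdsWithin_le_nhds (s := {A}ᶜ))
    simpa using this
  · have : ContinuousAt (fun s : ℝ => (s - A) ^ 2) A := by fun_prop
    have := this.tendsto.mono_left (nhdsWithin_le_nhds (s := {A}ᶜ))
    simpa using this
  · have h1 := (hasDerivAt_iff_tendsto_slope.1 hd).div_const 2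
    refine h1.congr' ?_
    filter_upwards [self_mem_nhdsWithin] with s hs
    rw [slope_def_field, hfA, sub_zero, div_div, mul_comm (s - A)]

theorem eventually_quadratic_le_productExponent (hA0 : 0 < A)
    (hA : L₂ * p₂ * A ^ (p₁ + p₂) = p₁ * L₁) (hm : 0 < L₂ * p₂ * (p₁ + p₂)) :
    ∀ᶠ s in 𝓝 A, L₂ * p₂ * (p₁ + p₂) * A ^ (p₂ - 2) / 2 / 2 * (s - A) ^ 2 ≤
      productExponent L₁ p₁ L₂ p₂ s - productExponent L₁ p₁ L₂ p₂ A := by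
  have hm' : 0 < L₂ * p₂ * (p₁ + p₂) * A ^ (p₂ - 2) / 2 := by positivity
  have h1 := (tendsto_productExponent_sub_div_sq hA0 hA).eventually_const_lt (half_lt_self hm')
  rw [eventually_nhdsWithin_iff] at h1
  filter_upwards [h1] with s hs
  rcases eq_or_ne s A with rfl | hne
  · simp
  · have h2 := hs hne
    have : 0 < (s - A) ^ 2 := by have := sub_ne_zero.2 hne; positivity
    rw [lt_div_iff₀ this] at h2
    exact h2.le

/-- Integrating by parts puts the nonnegative weight `h'` on the tail of `ν`, so two-sided tail
bounds pass to the integral and `h` recombines with the tail into the full exponent. The lower bound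
drops the boundary term at `a`, the upper bound the one at `b`. -/
theorem integral_weibull_bounds {ν : Measure ℝ} [IsFiniteMeasure ν] {a b w W G δ : ℝ}
    (hL₁ : 0 < L₁) (hp₁ : 0 < p₁) (ha : 0 < a) (hab : a ≤ b) (hw : 0 < w) (hW : 0 ≤ W)
    (hlow : ∀ s ∈ Icc a b, (1 - δ) * (G * Real.exp (-W * (L₂ * s ^ p₂))) ≤ ν.real (Ioi (s * w)))
    (hupp : ∀ s ∈ Icc a b, ν.real (Ioi (s * w)) ≤ (1 + δ) * (G * Real.exp (-W * (L₂ * s ^ p₂)))) :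
    G * ((1 - δ) * (W * ∫ s in a..b, L₁ * p₁ * s ^ (-p₁ - 1)
        * Real.exp (-W * productExponent L₁ p₁ L₂ p₂ s))
        - (1 + δ) * Real.exp (-W * productExponent L₁ p₁ L₂ p₂ b))
      ≤ ∫ y in Ioc (a * w) (b * w), Real.exp (-W * (L₁ * (y / w) ^ (-p₁))) ∂ν ∧
    ∫ y in Ioc (a * w) (b * w), Real.exp (-W * (L₁ * (y / w) ^ (-p₁))) ∂ν
      ≤ G * ((1 + δ) * (Real.exp (-W * productExponent L₁ p₁ L₂ p₂ a)
        + W * ∫ s in a..b, L₁ * p₁ * s ^ (-p₁ - 1)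
        * Real.exp (-W * productExponent L₁ p₁ L₂ p₂ s))) := by
  set h : ℝ → ℝ := fun s => Real.exp (-W * (L₁ * s ^ (-p₁))) with hh
  set h' : ℝ → ℝ := fun s => W * (L₁ * p₁ * s ^ (-p₁ - 1)) * h s with hh'
  have hpos : ∀ s ∈ Icc a b, 0 < s := fun s hs => ha.trans_le hs.1
  have hd : ∀ s ∈ Icc a b, HasDerivAt h (h' s) s := by
    intro s hs
    have h1 := (((Real.hasDerivAt_rpow_const (x := s) (p := -p₁)
      (Or.inl (hpos s hs).ne')).const_mul L₁).const_mul (-W)).exp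
    refine h1.congr_deriv ?_
    simp only [hh', hh]
    ring
  have hrc : ∀ q : ℝ, ContinuousOn (fun s : ℝ => s ^ q) (Icc a b) := fun q s hs =>
    (Real.continuousAt_rpow_const s q (Or.inl (hpos s hs).ne')).continuousWithinAt
  have hhc : ContinuousOn h (Icc a b) := fun s hs => (hd s hs).continuousAt.continuousWithinAt
  have hc : ContinuousOn h' (Icc a b) := by
    have := hrc (-p₁ - 1)
    fun_prop
  have hprod : ∀ s, h s * Real.exp (-W * (L₂ * s ^ p₂)) =
      Real.exp (-W * productExponent L₁ p₁ L₂ p₂ s) := by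
    intro s
    rw [hh, ← Real.exp_add, productExponent]
    congr 1
    ring
  have heq : ∀ C : ℝ, ∫ s in a..b, h' s * (C * (G * Real.exp (-W * (L₂ * s ^ p₂)))) =
      G * (C * (W * ∫ s in a..b, L₁ * p₁ * s ^ (-p₁ - 1)
        * Real.exp (-W * productExponent L₁ p₁ L₂ p₂ s))) := by
    intro C
    rw [← intervalIntegral.integral_const_mul, ← intervalIntegral.integral_const_mul,
      ← intervalIntegral.integral_const_mul]
    refine intervalIntegral.integral_congr fun s _ => ?_
    rw [← hprod s]
    simp only [hh']
    ring
  have hci : ∀ C : ℝ, IntervalIntegrable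
      (fun s => h' s * (C * (G * Real.exp (-W * (L₂ * s ^ p₂))))) volume a b := by
    intro C
    refine ContinuousOn.intervalIntegrable ?_
    rw [uIcc_of_le hab]
    have := hrc p₂
    fun_prop
  have hti : IntervalIntegrable (fun s => h' s * ν.real (Ioi (s * w))) volume a b := by
    have hanti : Antitone fun s => ν.real (Ioi (s * w)) := fun s t hst =>
      measureReal_mono (Ioi_subset_Ioi (by gcongr))
    rw [intervalIntegrable_iff_integrableOn_Ioc_of_le hab]
    refine Integrable.mul_bdd (c := ν.real univ)
      (hc.integrableOn_Icc.mono_set Ioc_subset_Icc_self) hanti.measurable.aestronglyMeasurable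
      (Eventually.of_forall fun s => ?_)
    rw [Real.norm_of_nonneg measureReal_nonneg]
    exact measureReal_mono (subset_univ _)
  have hh0 : ∀ s, 0 < h s := fun s => Real.exp_pos _
  have hh'0 : ∀ s ∈ Icc a b, 0 ≤ h' s := by
    intro s hs
    have := Real.rpow_pos_of_pos (hpos s hs) (-p₁ - 1)
    have := hh0 s
    positivity
  have key := setIntegral_Ioc_comp_div_eq_integral_tail (ν := ν) hab hw hd hc (by fun_prop)
  have hlowint := intervalIntegral.integral_mono_on hab (hci (1 - δ)) hti fun s hs =>
    mul_le_mul_of_nonneg_left (hlow s hs) (hh'0 s hs)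
  have huppint := intervalIntegral.integral_mono_on hab hti (hci (1 + δ)) fun s hs =>
    mul_le_mul_of_nonneg_left (hupp s hs) (hh'0 s hs)
  rw [heq] at hlowint huppint
  have hA1 := mul_le_mul_of_nonneg_left (hupp a ⟨le_rfl, hab⟩) (hh0 a).le
  have hB1 := mul_le_mul_of_nonneg_left (hupp b ⟨hab, le_rfl⟩) (hh0 b).le
  have hA2 : 0 ≤ h a * ν.real (Ioi (a * w)) := mul_nonneg (hh0 a).le measureReal_nonneg
  have hB2 : 0 ≤ h b * ν.real (Ioi (b * w)) := mul_nonneg (hh0 b).le measureReal_nonneg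
  have hA3 : h a * ((1 + δ) * (G * Real.exp (-W * (L₂ * a ^ p₂)))) =
    G * ((1 + δ) * Real.exp (-W * productExponent L₁ p₁ L₂ p₂ a)) := by rw [← hprod a]; ring
  have hB3 : h b * ((1 + δ) * (G * Real.exp (-W * (L₂ * b ^ p₂)))) =
    G * ((1 + δ) * Real.exp (-W * productExponent L₁ p₁ L₂ p₂ b)) := by rw [← hprod b]; ring
  rw [hA3] at hA1
  rw [hB3] at hB1
  rw [key]
  constructor
  · linarith
  · linarith

end Exponent

/-! ### The two scales whose product is `x` -/

section Scales

variable {p₁ p₂ : ℝ}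

theorem rpow_div_add_rpow {x p q : ℝ} (hx : 0 ≤ x) (r : ℝ) :
    (x ^ (p / (p + q))) ^ r = x ^ (p * r / (p + q)) := by
  rw [← Real.rpow_mul hx]
  congr 1
  ring

theorem div_mul_rpow_div_add {x s : ℝ} (hx : 0 < x) (hp : 0 < p₁) (hq : 0 < p₂) :
    x / (s * x ^ (p₁ / (p₁ + p₂))) = s⁻¹ * x ^ (p₂ / (p₁ + p₂)) := by
  have h1 : x ^ (p₁ / (p₁ + p₂)) * x ^ (p₂ / (p₁ + p₂)) = x := by
    rw [← Real.rpow_add hx, ← add_div, div_self (by positivity), Real.rpow_one]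
  have h2 := Real.rpow_pos_of_pos hx (p₁ / (p₁ + p₂))
  rcases eq_or_ne s 0 with rfl | hs
  · simp
  rw [div_eq_iff (by positivity)]
  calc x = x ^ (p₁ / (p₁ + p₂)) * x ^ (p₂ / (p₁ + p₂)) := h1.symm
    _ = _ := by field_simp

end Scales

/-! ### Negligibility away from the critical scale -/

section Outside

variable {Ω : Type*} [MeasurableSpace Ω] {μ : Measure Ω} [IsProbabilityMeasure μ] {X₁ X₂ : Ω → ℝ}

/-- Only the window `a w_x < X₂ ≤ b w_x` around the critical scale contributes to the tail of the
product. -/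
theorem tendsto_outside_window (hX₁ : Measurable X₁) (hX₂ : Measurable X₂)
    {p₁ p₂ L₁ L₂ A K β : ℝ} (hp₁ : 0 < p₁) (hp₂ : 0 < p₂) (hL₁ : 0 < L₁) (hL₂ : 0 < L₂)
    (hpos₁ : ∀ᶠ u in atTop, 0 < μ.real {ω | u < X₁ ω})
    (hpos₂ : ∀ᶠ u in atTop, 0 < μ.real {ω | u < X₂ ω})
    (hlog₁ : Tendsto (fun u => Real.log (μ.real {ω | u < X₁ ω}) / u ^ p₁) atTop (𝓝 (-L₁)))
    (hlog₂ : Tendsto (fun u => Real.log (μ.real {ω | u < X₂ ω}) / u ^ p₂) atTop (𝓝 (-L₂)))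
    (hA0 : 0 < A) (hA : L₂ * p₂ * A ^ (p₁ + p₂) = p₁ * L₁)
    {c : ℝ → ℝ → ℝ} (hK : 0 < K)
    (hcond : ∀ᶠ x : ℝ in atTop, ∀ᵐ y ∂(μ.map X₂),
      (condDistrib X₁ X₂ μ y).real (Ioi (x / y)) = μ.real {ω | x / y < X₁ ω} * c x y)
    (hbound : ∀ᶠ x : ℝ in atTop, ∀ y : ℝ, 0 < y → c x y ≤ K * x ^ β)
    {M : ℝ → ℝ} (hM : ∀ᶠ x in atTop, 0 < M x)
    (hMlog : Tendsto (fun x => Real.log (M x) / x ^ (p₁ * p₂ / (p₁ + p₂))) atTop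
      (𝓝 (-productExponent L₁ p₁ L₂ p₂ A)))
    {a b : ℝ} (haA : a < A) (hAb : A < b) :
    Tendsto (fun x => μ.real {ω | x < X₁ ω * X₂ ω ∧
      X₂ ω / x ^ (p₁ / (p₁ + p₂)) ∈ Ioc 0 a ∪ Ioi b} / M x) atTop (𝓝 0) := by
  have hpp : 0 < p₁ + p₂ := by positivity
  set W : ℝ → ℝ := fun x => x ^ (p₁ * p₂ / (p₁ + p₂)) with hWdef
  set w : ℝ → ℝ := fun x => x ^ (p₁ / (p₁ + p₂)) with hwdef
  set V : ℝ → ℝ := fun x => x ^ (p₂ / (p₁ + p₂)) with hVdef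
  have hW : Tendsto W atTop atTop := tendsto_rpow_atTop (by positivity)
  have hw : Tendsto w atTop atTop := tendsto_rpow_atTop (by positivity)
  have hV : Tendsto V atTop atTop := tendsto_rpow_atTop (by positivity)
  have hwW : ∀ᶠ x in atTop, w x ^ p₂ = W x := by
    filter_upwards [eventually_ge_atTop 0] with x hx using rpow_div_add_rpow hx p₂
  have hVW : ∀ᶠ x in atTop, V x ^ p₁ = W x := by
    filter_upwards [eventually_ge_atTop 0] with x hx
    simp only [hVdef, hWdef]
    rw [← Real.rpow_mul hx]
    congr 1
    ring
  have hKlog : Tendsto (fun x => Real.log (K * x ^ β) / W x) atTop (𝓝 0) :=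
    tendsto_log_const_mul_rpow_div hK (by positivity)
  have hKpos : ∀ᶠ x : ℝ in atTop, 0 < K * x ^ β := by
    filter_upwards [eventually_gt_atTop 0] with x hx using by positivity
  have hF₁pos : ∀ v, 0 < v → ∀ᶠ x in atTop, 0 < μ.real {ω | v⁻¹ * V x < X₁ ω} := fun v hv =>
    (hV.const_mul_atTop (inv_pos.2 hv)).eventually hpos₁
  have hF₂pos : ∀ u, 0 < u → ∀ᶠ x in atTop, 0 < μ.real {ω | u * w x < X₂ ω} := fun u hu =>
    (hw.const_mul_atTop hu).eventually hpos₂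
  have hF₁log : ∀ v, 0 < v → Tendsto
      (fun x => Real.log (μ.real {ω | v⁻¹ * V x < X₁ ω}) / W x) atTop
      (𝓝 (-L₁ * v ^ (-p₁))) := by
    intro v hv
    have := tendsto_log_comp_div (F := fun u => μ.real {ω | u < X₁ ω}) (inv_pos.2 hv) hlog₁ hV hVW
    rwa [Real.inv_rpow hv.le, ← Real.rpow_neg hv.le] at this
  have hF₂log : ∀ u, 0 < u → Tendsto
      (fun x => Real.log (μ.real {ω | u * w x < X₂ ω}) / W x) atTop
      (𝓝 (-L₂ * u ^ p₂)) := fun u hu =>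
    tendsto_log_comp_div (F := fun u => μ.real {ω | u < X₂ ω}) hu hlog₂ hw hwW
  set E : ℝ → Set ℝ → ℝ := fun x S => μ.real {ω | x < X₁ ω * X₂ ω ∧ X₂ ω / w x ∈ S} with hE
  -- Negligible sets of scaled values `X₂ / w` are stable under subsets and finite unions, as
  -- compact induction requires.
  set Neg : Set ℝ → Prop := fun S => Tendsto (fun x => E x S / M x) atTop (𝓝 0) with hNeg
  have mono : ∀ S T : Set ℝ, S ⊆ T → Neg T → Neg S := by
    intro S T hST hT
    refine squeeze_zero' ?_ ?_ hT
    · filter_upwards [hM] with x hx using div_nonneg measureReal_nonneg hx.le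
    · filter_upwards [hM] with x hx
      refine div_le_div_of_nonneg_right (measureReal_mono ?_) hx.le
      exact fun ω hω => ⟨hω.1, hST hω.2⟩
  have union : ∀ S T : Set ℝ, Neg S → Neg T → Neg (S ∪ T) := by
    intro S T hS hT
    have h := hS.add hT
    rw [add_zero] at h
    refine squeeze_zero' ?_ ?_ h
    · filter_upwards [hM] with x hx using div_nonneg measureReal_nonneg hx.le
    · filter_upwards [hM] with x hx
      rw [← add_div]
      refine div_le_div_of_nonneg_right ((measureReal_mono ?_).trans (measureReal_union_le _ _))
        hx.le
      rintro ω ⟨h1, h2 | h2⟩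
      · exact Or.inl ⟨h1, h2⟩
      · exact Or.inr ⟨h1, h2⟩
  have upper : ∀ v, 0 < v → ∀ S : Set ℝ, MeasurableSet S → S ⊆ Ioc 0 v → ∀ᶠ x in atTop,
      E x S ≤ K * x ^ β * μ.real {ω | v⁻¹ * V x < X₁ ω} *
        (μ.map X₂).real {y | y / w x ∈ S} := by
    intro v hv S hS hSv
    filter_upwards [hcond, hbound, hKpos, eventually_gt_atTop 0, hw.eventually_gt_atTop 0]
      with x h1 h2 h3 h4 h5
    have h6 := measureReal_mul_tail_inter_le hX₁ hX₂ (v := v * w x) (T := {y | y / w x ∈ S})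
      h4.le h3.le (hS.preimage (by fun_prop : Measurable fun y : ℝ => y / w x)) ?_ h1 h2
    · rw [hwdef, div_mul_rpow_div_add h4 hp₁ hp₂] at h6
      exact h6
    · intro y hy
      have := hSv hy
      simp only [mem_Ioc] at this
      rw [div_le_iff₀ h5] at this
      exact ⟨(div_pos_iff_of_pos_right h5).1 this.1, this.2⟩
  -- Near `0` the tail of `X₁` alone beats the main term.
  have small : ∀ v, 0 < v → productExponent L₁ p₁ L₂ p₂ A < L₁ * v ^ (-p₁) → Neg (Ioc 0 v) := by
    intro v hv hlt
    have h1 : Tendsto (fun x => K * x ^ β * μ.real {ω | v⁻¹ * V x < X₁ ω} / M x)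
        atTop (𝓝 0) := by
      refine tendsto_div_zero_of_log (a := -L₁ * v ^ (-p₁)) hW ?_ hM ?_ hMlog (by linarith)
      · filter_upwards [hKpos, hF₁pos v hv] with x hx hx' using by positivity
      · have := hKlog.add (hF₁log v hv)
        rw [zero_add] at this
        refine this.congr' ?_
        filter_upwards [hKpos, hF₁pos v hv] with x hx hx'
        rw [Real.log_mul hx.ne' hx'.ne', add_div]
    refine squeeze_zero' ?_ ?_ h1
    · filter_upwards [hM] with x hx using div_nonneg measureReal_nonneg hx.le
    · filter_upwards [hM, upper v hv _ measurableSet_Ioc subset_rfl, hKpos] with x hx hu hk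
      refine div_le_div_of_nonneg_right (hu.trans ?_) hx.le
      have : IsProbabilityMeasure (μ.map X₂) := Measure.isProbabilityMeasure_map hX₂.aemeasurable
      exact mul_le_of_le_one_right (mul_nonneg hk.le measureReal_nonneg) measureReal_le_one
  -- Near infinity the tail of `X₂` alone suffices, without conditioning.
  have large : ∀ u, 0 < u → productExponent L₁ p₁ L₂ p₂ A < L₂ * u ^ p₂ → Neg (Ioi u) := by
    intro u hu hlt
    have h1 : Tendsto (fun x => μ.real {ω | u * w x < X₂ ω} / M x) atTop (𝓝 0) :=
      tendsto_div_zero_of_log hW (hF₂pos u hu) hM (hF₂log u hu) hMlog (by linarith)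
    refine squeeze_zero' ?_ ?_ h1
    · filter_upwards [hM] with x hx using div_nonneg measureReal_nonneg hx.le
    · filter_upwards [hM, hw.eventually_gt_atTop 0] with x hx hw0
      refine div_le_div_of_nonneg_right (measureReal_mono fun ω hω => ?_) hx.le
      exact (lt_div_iff₀ hw0).1 hω.2
  -- On a cell each tail is taken at its worst endpoint: `v` for `X₁`, `u` for `X₂`.
  have middle : ∀ u v, 0 < u → u < v →
      productExponent L₁ p₁ L₂ p₂ A < L₁ * v ^ (-p₁) + L₂ * u ^ p₂ → Neg (Ioo u v) := by
    intro u v hu huv hlt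
    have hv := hu.trans huv
    have h1 : Tendsto (fun x => K * x ^ β * μ.real {ω | v⁻¹ * V x < X₁ ω} *
        μ.real {ω | u * w x < X₂ ω} / M x) atTop (𝓝 0) := by
      refine tendsto_div_zero_of_log (a := -L₁ * v ^ (-p₁) + -L₂ * u ^ p₂) hW ?_ hM ?_ hMlog
        (by linarith)
      · filter_upwards [hKpos, hF₁pos v hv, hF₂pos u hu] with x hx hx' hx'' using by positivity
      · have := (hKlog.add (hF₁log v hv)).add (hF₂log u hu)
        rw [zero_add] at this
        refine this.congr' ?_
        filter_upwards [hKpos, hF₁pos v hv, hF₂pos u hu] with x hx hx' hx''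
        rw [Real.log_mul (by positivity) hx''.ne', Real.log_mul hx.ne' hx'.ne', add_div, add_div]
    refine squeeze_zero' ?_ ?_ h1
    · filter_upwards [hM] with x hx using div_nonneg measureReal_nonneg hx.le
    · filter_upwards [hM, hKpos, hw.eventually_gt_atTop 0, upper v hv _ measurableSet_Ioo
        (fun s hs => ⟨hu.trans hs.1, hs.2.le⟩)] with x hx hk hw0 hup
      refine div_le_div_of_nonneg_right (hup.trans ?_) hx.le
      refine mul_le_mul_of_nonneg_left ?_ (mul_nonneg hk.le measureReal_nonneg)
      rw [map_measureReal_apply hX₂ (s := {y | y / w x ∈ Ioo u v})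
        (measurableSet_Ioo.preimage (by fun_prop : Measurable fun y : ℝ => y / w x))]
      exact measureReal_mono fun ω hω => (lt_div_iff₀ hw0).1 hω.1
  have hcompact : ∀ k : Set ℝ, IsCompact k → k ⊆ Ioi 0 \ {A} → Neg k := by
    intro k hk hkA
    refine hk.induction_on (p := Neg) ?_ (fun S T hST hT => mono S T hST hT)
      (fun S T hS hT => union S T hS hT) ?_
    · simp [hNeg, hE]
    · intro s hs
      obtain ⟨hs0, hsA⟩ := hkA hs
      have hs0 : 0 < s := hs0
      have hlt := productExponent_lt hpp (mul_pos hL₂ hp₂) hA0 hA hs0 hsA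
      -- As the cell shrinks to `s ≠ A`, its worst-case exponent tends to the value at `s`, which
      -- exceeds the minimum.
      have hc : ContinuousAt (fun t : ℝ => L₁ * (s + t) ^ (-p₁) + L₂ * (s - t) ^ p₂) 0 := by
        have h1 : ContinuousAt (fun t : ℝ => (s + t) ^ (-p₁)) 0 :=
          ContinuousAt.rpow_const (by fun_prop) (Or.inl (by simpa using hs0.ne'))
        have h2 : ContinuousAt (fun t : ℝ => (s - t) ^ p₂) 0 :=
          ContinuousAt.rpow_const (by fun_prop) (Or.inl (by simpa using hs0.ne'))
        fun_prop
      have h1 := (hc.tendsto.eventually_const_lt (u := productExponent L₁ p₁ L₂ p₂ A)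
        (by simpa [productExponent] using hlt)).filter_mono (nhdsWithin_le_nhds (s := Ioi 0))
      have h2 : ∀ᶠ t : ℝ in 𝓝[>] 0, t ∈ Ioo 0 s := Ioo_mem_nhdsGT hs0
      obtain ⟨t, ht1, ht2⟩ := (h1.and h2).exists
      exact ⟨Ioo (s - t) (s + t), mem_nhdsWithin_of_mem_nhds
        (Ioo_mem_nhds (by linarith [ht2.1]) (by linarith [ht2.1])),
        middle _ _ (by linarith [ht2.2]) (by linarith [ht2.1]) ht1⟩
  obtain ⟨v₀, hv₀, hv₀B⟩ : ∃ v, 0 < v ∧ productExponent L₁ p₁ L₂ p₂ A < L₁ * v ^ (-p₁) := by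
    have h1 : Tendsto (fun t : ℝ => L₁ * t ^ p₁) atTop atTop :=
      (tendsto_rpow_atTop hp₁).const_mul_atTop hL₁
    obtain ⟨t, ht, ht0⟩ := ((h1.eventually_gt_atTop
      (productExponent L₁ p₁ L₂ p₂ A)).and (eventually_gt_atTop 0)).exists
    refine ⟨t⁻¹, inv_pos.2 ht0, ?_⟩
    rwa [Real.inv_rpow ht0.le, Real.rpow_neg ht0.le, inv_inv]
  obtain ⟨u₀, hu₀B, hu₀⟩ : ∃ u, productExponent L₁ p₁ L₂ p₂ A < L₂ * u ^ p₂ ∧ 0 < u :=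
    ((((tendsto_rpow_atTop hp₂).const_mul_atTop hL₂).eventually_gt_atTop _).and
      (eventually_gt_atTop 0)).exists
  have hmid : Neg (Icc v₀ a ∪ Icc b u₀) := by
    refine hcompact _ (isCompact_Icc.union isCompact_Icc) ?_
    rintro s (hs | hs)
    · exact ⟨hv₀.trans_le hs.1, (hs.2.trans_lt haA).ne⟩
    · exact ⟨(hA0.trans hAb).trans_le hs.1, (hAb.trans_le hs.1).ne'⟩
  refine mono _ _ ?_ (union _ _ (union _ _ (small v₀ hv₀ hv₀B) hmid) (large u₀ hu₀ hu₀B))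
  rintro s (hs | hs)
  · rcases le_total s v₀ with h | h
    · exact Or.inl (Or.inl ⟨hs.1, h⟩)
    · exact Or.inl (Or.inr (Or.inl ⟨h, hs.2⟩))
  · rcases le_or_gt s u₀ with h | h
    · exact Or.inl (Or.inr (Or.inr ⟨le_of_lt hs, h⟩))
    · exact Or.inr h

end Outside

/-! ### The window around the critical scale -/

/-- Makes the boundary terms of the integration by parts negligible against the Laplace main term.
-/
theorem tendsto_exp_div_mul_sqrt_mul_exp {κ B t : ℝ} (hκ : 0 < κ) (hBt : B < t) :
    Tendsto (fun W : ℝ => Real.exp (-W * t) / (κ * (√W * Real.exp (-W * B)))) atTop (𝓝 0) := by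
  have h1 : Tendsto (fun W : ℝ => Real.exp (-(W * (t - B)))) atTop (𝓝 0) :=
    Real.tendsto_exp_neg_atTop_nhds_zero.comp (tendsto_id.atTop_mul_const (sub_pos.2 hBt))
  have h2 : Tendsto (fun W : ℝ => (κ * √W)⁻¹) atTop (𝓝 0) :=
    tendsto_inv_atTop_zero.comp (Real.tendsto_sqrt_atTop.const_mul_atTop hκ)
  have h3 := h1.mul h2
  rw [mul_zero] at h3
  refine h3.congr' ?_
  filter_upwards [eventually_gt_atTop 0] with W hW
  have := Real.sqrt_pos.2 hW
  rw [show -(W * (t - B)) = -W * t - -W * B by ring, Real.exp_sub]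
  field_simp

/-- Uniform statements along `l ×ˢ 𝓝 A` hold on a fixed compact window around `A > 0`. -/
theorem exists_window_of_eventually_prod {l : Filter ℝ} {P : ℝ × ℝ → Prop} {A : ℝ} (hA : 0 < A)
    (h : ∀ᶠ q : ℝ × ℝ in l ×ˢ 𝓝 A, P q) :
    ∃ a b, 0 < a ∧ a < A ∧ A < b ∧ ∀ᶠ x in l, ∀ s ∈ Icc a b, P (x, s) := by
  obtain ⟨pa, hpa, pb, hpb, hP⟩ := eventually_prod_iff.1 h
  obtain ⟨r, hr, hball⟩ := Metric.nhds_basis_closedBall.eventually_iff.1 hpb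
  refine ⟨A - min r (A / 2), A + min r (A / 2), ?_, ?_, ?_, ?_⟩
  · linarith [min_le_right r (A / 2)]
  · have : 0 < min r (A / 2) := by positivity
    linarith
  · have : 0 < min r (A / 2) := by positivity
    linarith
  · filter_upwards [hpa] with x hx s hs
    refine hP hx (hball ?_)
    rw [Real.closedBall_eq_Icc]
    exact ⟨by linarith [hs.1, min_le_left r (A / 2)], by linarith [hs.2, min_le_left r (A / 2)]⟩

/-- The upper factor is `(1 + δ)² (1 + 2δ) = 1 + 4δ + 5δ² + 2δ³`, at most `1 + 11δ` when `δ ≤ 1`;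
the lower one is `(1 - δ)(1 - 3δ) ≥ 1 - 4δ`. -/
theorem abs_sub_one_le_of_sandwich {P N G I S S₁ S₂ S₃ δ : ℝ} (hδ0 : 0 < δ) (hδ1 : δ ≤ 1)
    (hN : 0 < N) (hG : 0 < G) (hS : 0 < S) (hlow : (1 - δ) * (N * I) ≤ P)
    (hupp : P ≤ (1 + δ) * (N * I)) (hIlow : G * ((1 - δ) * S₂ - (1 + δ) * S₃) ≤ I)
    (hIupp : I ≤ G * ((1 + δ) * (S₁ + S₂))) (h1 : S₁ / S ≤ δ) (h2 : |S₂ / S - 1| ≤ δ)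
    (h3 : S₃ / S ≤ δ) : |P / (N * G * S) - 1| ≤ 11 * δ := by
  rw [abs_le] at h2
  have h2l : (1 - δ) * S ≤ S₂ := by rw [← le_div_iff₀ hS]; linarith
  have h2u : S₂ ≤ (1 + δ) * S := by rw [← div_le_iff₀ hS]; linarith
  rw [div_le_iff₀ hS] at h1 h3
  have hIu : I ≤ G * ((1 + δ) * (1 + 2 * δ) * S) := by
    refine hIupp.trans (mul_le_mul_of_nonneg_left ?_ hG.le)
    rw [mul_assoc]
    exact mul_le_mul_of_nonneg_left (by linarith) (by linarith)
  have hIl : G * ((1 - 3 * δ) * S) ≤ I := by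
    refine le_trans (mul_le_mul_of_nonneg_left ?_ hG.le) hIlow
    have e1 := mul_le_mul_of_nonneg_left h2l (sub_nonneg.2 hδ1)
    have e2 := mul_le_mul_of_nonneg_left h3 (show 0 ≤ 1 + δ by linarith)
    nlinarith
  have hNGS : 0 < N * G * S := by positivity
  have hPu : P ≤ (1 + δ) * ((1 + δ) * (1 + 2 * δ)) * (N * G * S) := by
    refine hupp.trans ?_
    have := mul_le_mul_of_nonneg_left hIu (show 0 ≤ (1 + δ) * N by positivity)
    linarith
  have hPl : (1 - δ) * (1 - 3 * δ) * (N * G * S) ≤ P := by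
    refine le_trans ?_ hlow
    have := mul_le_mul_of_nonneg_left hIl (mul_nonneg (sub_nonneg.2 hδ1) hN.le)
    linarith
  rw [← div_le_iff₀ hNGS] at hPu
  rw [← le_div_iff₀ hNGS] at hPl
  rw [abs_le]
  constructor
  · nlinarith
  · nlinarith [mul_nonneg hδ0.le (sub_nonneg.2 hδ1), mul_nonneg (mul_nonneg hδ0.le hδ0.le)
      (sub_nonneg.2 hδ1)]

section Inside

variable {Ω : Type*} [MeasurableSpace Ω] {μ : Measure Ω} [IsProbabilityMeasure μ] {X₁ X₂ : Ω → ℝ}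

/-- The contribution of a small window around the critical scale. -/
theorem exists_window_tail (hX₁ : Measurable X₁) (hX₂ : Measurable X₂)
    {p₁ p₂ L₁ L₂ A D q₁ q₂ a₁ a₂ : ℝ} (hp₁ : 0 < p₁) (hp₂ : 0 < p₂) (hL₁ : 0 < L₁) (hL₂ : 0 < L₂)
    {g₁ g₂ : ℝ → ℝ} {α₁ α₂ : ℝ}
    (hg₁ : IsRegularlyVarying g₁ α₁) (hg₂ : IsRegularlyVarying g₂ α₂)
    (hmon₁ : IsUltimatelyMonotone g₁) (hmon₂ : IsUltimatelyMonotone g₂)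
    (htail₁ : HasWeibullTail μ X₁ g₁ L₁ p₁) (htail₂ : HasWeibullTail μ X₂ g₂ L₂ p₂)
    (hA0 : 0 < A) (hA : L₂ * p₂ * A ^ (p₁ + p₂) = p₁ * L₁)
    {c : ℝ → ℝ → ℝ}
    (hcond : ∀ᶠ x : ℝ in atTop, ∀ᵐ y ∂(μ.map X₂),
      (condDistrib X₁ X₂ μ y).real (Ioi (x / y)) = μ.real {ω | x / y < X₁ ω} * c x y)
    (hD : 0 < D) (ha₁A : a₁ < A) (hAa₂ : A < a₂)
    (hunif : ∀ ε : ℝ, 0 < ε → ∀ᶠ x : ℝ in atTop,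
      ∀ y ∈ Icc (a₁ * x ^ (p₁ / (p₁ + p₂))) (a₂ * x ^ (p₁ / (p₁ + p₂))),
        |c x y / (D * x ^ q₁ * y ^ (q₂ - q₁)) - 1| ≤ ε)
    {ε : ℝ} (hε : 0 < ε) :
    ∃ a b, 0 < a ∧ a < A ∧ A < b ∧ ∀ᶠ x in atTop,
      |μ.real {ω | x < X₁ ω * X₂ ω ∧ X₂ ω / x ^ (p₁ / (p₁ + p₂)) ∈ Ioc a b} /
        (D * x ^ q₁ * (A * x ^ (p₁ / (p₁ + p₂))) ^ (q₂ - q₁) *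
          g₁ (A⁻¹ * x ^ (p₂ / (p₁ + p₂))) * g₂ (A * x ^ (p₁ / (p₁ + p₂))) *
          (L₁ * p₁ * A ^ (-p₁ - 1) *
            √(Real.pi / (L₂ * p₂ * (p₁ + p₂) * A ^ (p₂ - 2) / 2)) *
            (√(x ^ (p₁ * p₂ / (p₁ + p₂))) *
              Real.exp (-x ^ (p₁ * p₂ / (p₁ + p₂)) * productExponent L₁ p₁ L₂ p₂ A)))) - 1| ≤ ε := by
  have : IsProbabilityMeasure (μ.map X₂) := Measure.isProbabilityMeasure_map hX₂.aemeasurable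
  have hpp : 0 < p₁ + p₂ := by positivity
  set W : ℝ → ℝ := fun x => x ^ (p₁ * p₂ / (p₁ + p₂)) with hWdef
  set w : ℝ → ℝ := fun x => x ^ (p₁ / (p₁ + p₂)) with hwdef
  set V : ℝ → ℝ := fun x => x ^ (p₂ / (p₁ + p₂)) with hVdef
  set m : ℝ := L₂ * p₂ * (p₁ + p₂) * A ^ (p₂ - 2) / 2 with hmdef
  have hm : 0 < m := by positivity
  set κ : ℝ := L₁ * p₁ * A ^ (-p₁ - 1) * √(Real.pi / m) with hκdef
  have hκ : 0 < κ := by positivity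
  have hW : Tendsto W atTop atTop := tendsto_rpow_atTop (by positivity)
  have hw : Tendsto w atTop atTop := tendsto_rpow_atTop (by positivity)
  have hV : Tendsto V atTop atTop := tendsto_rpow_atTop (by positivity)
  have hwW : ∀ x, 0 ≤ x → w x ^ p₂ = W x := fun x hx => rpow_div_add_rpow hx p₂
  have hVW : ∀ x, 0 ≤ x → V x ^ p₁ = W x := by
    intro x hx
    simp only [hVdef, hWdef]
    rw [← Real.rpow_mul hx]
    congr 1
    ring
  -- At `y = s w` the argument `x / y` is `s⁻¹ V`, so the tail of `X₁` is frozen around `A⁻¹`.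
  have hV' : Tendsto (fun q : ℝ × ℝ => (V q.1, q.2⁻¹)) (atTop ×ˢ 𝓝 A) (atTop ×ˢ 𝓝 A⁻¹) :=
    (hV.comp tendsto_fst).prodMk ((tendsto_inv₀ hA0.ne').comp tendsto_snd)
  have hw' : Tendsto (fun q : ℝ × ℝ => (w q.1, q.2)) (atTop ×ˢ 𝓝 A) (atTop ×ˢ 𝓝 A) :=
    (hw.comp tendsto_fst).prodMk tendsto_snd
  have hf₁ := (tendsto_tail_prod (inv_pos.2 hA0) hg₁ hmon₁ htail₁).comp hV'
  have hf₂ := (tendsto_tail_prod hA0 hg₂ hmon₂ htail₂).comp hw'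
  have hfc : Tendsto (fun q : ℝ × ℝ => c q.1 (q.2 * w q.1) /
      (D * q.1 ^ q₁ * (q.2 * w q.1) ^ (q₂ - q₁))) (atTop ×ˢ 𝓝 A) (𝓝 1) := by
    rw [Metric.tendsto_nhds]
    intro η hη
    have hmem : ∀ᶠ s in 𝓝 A, s ∈ Icc a₁ a₂ := Icc_mem_nhds ha₁A hAa₂
    filter_upwards [((hunif (η / 2) (by positivity)).and (hw.eventually_gt_atTop 0)).prod_mk hmem]
      with ⟨x, s⟩ ⟨⟨h1, h2⟩, h3⟩
    rw [Real.dist_eq]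
    refine (h1 _ ⟨?_, ?_⟩).trans_lt (half_lt_self hη)
    · exact mul_le_mul_of_nonneg_right h3.1 h2.le
    · exact mul_le_mul_of_nonneg_right h3.2 h2.le
  -- Price of replacing `(s w) ^ (q₂ - q₁)` by `(A w) ^ (q₂ - q₁)`.
  have hfs : Tendsto (fun q : ℝ × ℝ => (q.2 / A) ^ (q₂ - q₁)) (atTop ×ˢ 𝓝 A) (𝓝 1) := by
    have : Tendsto (fun s : ℝ => (s / A) ^ (q₂ - q₁)) (𝓝 A) (𝓝 1) := by
      have hc : ContinuousAt (fun s : ℝ => (s / A) ^ (q₂ - q₁)) A :=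
        ContinuousAt.rpow_const (by fun_prop) (Or.inl (by simp [hA0.ne']))
      have := hc.tendsto
      rwa [div_self hA0.ne', Real.one_rpow] at this
    exact this.comp tendsto_snd
  have hF₁ := (hf₁.mul hfc).mul hfs
  rw [one_mul, one_mul] at hF₁
  set δ : ℝ := min (ε / 11) 1 with hδdef
  have hδ0 : 0 < δ := by positivity
  have hδ1 : δ ≤ 1 := min_le_right _ _
  have hδε : 11 * δ ≤ ε := by linarith [min_le_left (ε / 11) 1]
  have hwin := ((hF₁.eventually (Metric.closedBall_mem_nhds _ hδ0)).and
    (hf₂.eventually (Metric.closedBall_mem_nhds _ hδ0))).and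
    (tendsto_snd.eventually (eventually_quadratic_le_productExponent hA0 hA
      (show 0 < L₂ * p₂ * (p₁ + p₂) by positivity)))
  obtain ⟨a, b, ha, haA, hAb, hab⟩ := exists_window_of_eventually_prod hA0 hwin
  refine ⟨a, b, ha, haA, hAb, ?_⟩
  have hquad : ∀ s ∈ Icc a b, m / 2 * (s - A) ^ 2 ≤
      productExponent L₁ p₁ L₂ p₂ s - productExponent L₁ p₁ L₂ p₂ A := by
    -- The quadratic bound does not involve `x`, so any one `x` yields it.
    obtain ⟨x, hx⟩ := hab.exists
    exact fun s hs => (hx s hs).2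
  have hk : ContinuousOn (fun s : ℝ => L₁ * p₁ * s ^ (-p₁ - 1)) (Icc a b) := fun s hs =>
    ((Real.continuousAt_rpow_const s _
      (Or.inl (ha.trans_le hs.1).ne')).const_mul _).continuousWithinAt
  have hlap := (tendsto_laplace_integral (k := fun s => L₁ * p₁ * s ^ (-p₁ - 1)) haA hAb hm
    measurable_productExponent (by fun_prop) hk hquad
    (tendsto_productExponent_sub_div_sq hA0 hA)).comp hW
  have hlap' : Tendsto (fun x => (W x * ∫ s in a..b, L₁ * p₁ * s ^ (-p₁ - 1)
      * Real.exp (-W x * productExponent L₁ p₁ L₂ p₂ s)) /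
      (κ * (√(W x) * Real.exp (-W x * productExponent L₁ p₁ L₂ p₂ A)))) atTop (𝓝 1) := by
    have h1 := hlap.div_const κ
    rw [div_self hκ.ne'] at h1
    refine h1.congr' ?_
    filter_upwards [hW.eventually_gt_atTop 0] with x hx
    have h2 := Real.sqrt_pos.2 hx
    simp only [Function.comp]
    rw [neg_mul (W x) (productExponent L₁ p₁ L₂ p₂ A), Real.exp_neg]
    field_simp
    rw [Real.sq_sqrt hx.le]
  have hend : ∀ t, 0 < t → t ≠ A → ∀ᶠ x in atTop,
      Real.exp (-W x * productExponent L₁ p₁ L₂ p₂ t) /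
      (κ * (√(W x) * Real.exp (-W x * productExponent L₁ p₁ L₂ p₂ A))) ≤ δ := fun t ht htA =>
    ((tendsto_exp_div_mul_sqrt_mul_exp hκ (productExponent_lt hpp (mul_pos hL₂ hp₂) hA0 hA ht
      htA)).comp hW).eventually_le_const hδ0
  filter_upwards [hab, hcond, hlap'.eventually (Metric.closedBall_mem_nhds _ hδ0),
    hend a ha haA.ne, hend b (hA0.trans hAb) hAb.ne', hw.eventually_gt_atTop 0,
    hW.eventually_gt_atTop 0, eventually_gt_atTop 0, hV.eventually_gt_atTop 0,
    (hV.const_mul_atTop (inv_pos.2 hA0)).eventually hg₁.eventually_pos,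
    (hw.const_mul_atTop hA0).eventually hg₂.eventually_pos]
    with x hab hcx hlx hax hbx hwx hWx hx hVx hg₁x hg₂x
  have hν : ∀ u, (μ.map X₂).real (Ioi u) = μ.real {ω | u < X₂ ω} := fun u =>
    map_measureReal_apply hX₂ measurableSet_Ioi
  set N : ℝ := D * x ^ q₁ * (A * w x) ^ (q₂ - q₁) * g₁ (A⁻¹ * V x) with hN
  have hAw : 0 < (A * w x) ^ (q₂ - q₁) := Real.rpow_pos_of_pos (by positivity) _
  have hN0 : 0 < N := by positivity
  have htail : ∀ s ∈ Icc a b,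
      (1 - δ) * (g₂ (A * w x) * Real.exp (-W x * (L₂ * s ^ p₂))) ≤ (μ.map X₂).real (Ioi (s * w x)) ∧
      (μ.map X₂).real (Ioi (s * w x)) ≤
        (1 + δ) * (g₂ (A * w x) * Real.exp (-W x * (L₂ * s ^ p₂))) := by
    intro s hs
    have hs0 := ha.trans_le hs.1
    have h := (hab s hs).1.2
    simp only [Function.comp] at h
    rw [Real.mul_rpow hs0.le hwx.le, hwW x hx.le, ← hν, Real.dist_eq,
      abs_le, show -L₂ * (s ^ p₂ * W x) = -W x * (L₂ * s ^ p₂) by ring] at h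
    constructor
    · rw [← le_div_iff₀ (by positivity)]; linarith [h.1]
    · rw [← div_le_iff₀ (by positivity)]; linarith [h.2]
  have hker : ∀ y ∈ Ioc (a * w x) (b * w x),
      (1 - δ) * (N * Real.exp (-W x * (L₁ * (y / w x) ^ (-p₁)))) ≤
        μ.real {ω | x / y < X₁ ω} * c x y ∧
      μ.real {ω | x / y < X₁ ω} * c x y ≤
        (1 + δ) * (N * Real.exp (-W x * (L₁ * (y / w x) ^ (-p₁)))) := by
    intro y hy
    have hs : y / w x ∈ Icc a b :=
      ⟨(le_div_iff₀ hwx).2 hy.1.le, (div_le_iff₀ hwx).2 hy.2⟩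
    obtain ⟨s, rfl⟩ : ∃ s, y = s * w x := ⟨y / w x, (div_mul_cancel₀ y hwx.ne').symm⟩
    rw [mul_div_cancel_right₀ s hwx.ne'] at hs ⊢
    have hs0 := ha.trans_le hs.1
    have h := (hab s hs).1.1
    simp only [Function.comp] at h
    have hsp := Real.rpow_pos_of_pos hs0 (q₂ - q₁)
    have hAp := Real.rpow_pos_of_pos hA0 (q₂ - q₁)
    have hwp := Real.rpow_pos_of_pos hwx (q₂ - q₁)
    have hxp := Real.rpow_pos_of_pos hx q₁
    have e : μ.real {ω | s⁻¹ * V x < X₁ ω} /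
        (g₁ (A⁻¹ * V x) * Real.exp (-L₁ * (s⁻¹ * V x) ^ p₁)) *
        (c x (s * w x) / (D * x ^ q₁ * (s * w x) ^ (q₂ - q₁))) * (s / A) ^ (q₂ - q₁) =
        μ.real {ω | x / (s * w x) < X₁ ω} * c x (s * w x) /
          (N * Real.exp (-W x * (L₁ * s ^ (-p₁)))) := by
      rw [Real.mul_rpow (inv_pos.2 hs0).le hVx.le, hVW x hx.le, Real.inv_rpow hs0.le,
        ← Real.rpow_neg hs0.le, show -L₁ * (s ^ (-p₁) * W x) = -W x * (L₁ * s ^ (-p₁)) by ring,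
        show x / (s * w x) = s⁻¹ * V x from div_mul_rpow_div_add hx hp₁ hp₂, hN, Real.mul_rpow hs0.le hwx.le,
        Real.mul_rpow hA0.le hwx.le, Real.div_rpow hs0.le hA0.le]
      generalize μ.real {ω | s⁻¹ * V x < X₁ ω} = F
      field_simp
    rw [e, Real.dist_eq, abs_le] at h
    constructor
    · rw [← le_div_iff₀ (by positivity)]; linarith [h.1]
    · rw [← div_le_iff₀ (by positivity)]; linarith [h.2]
  obtain ⟨hint, heq⟩ := measureReal_mul_tail_inter hX₁ hX₂ (T := Ioc (a * w x) (b * w x))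
    measurableSet_Ioc (fun y hy => (mul_pos ha hwx).trans hy.1) hcx
  have hset : {ω | x < X₁ ω * X₂ ω ∧ X₂ ω / w x ∈ Ioc a b} =
      {ω | x < X₁ ω * X₂ ω ∧ X₂ ω ∈ Ioc (a * w x) (b * w x)} := by
    ext ω
    simp [lt_div_iff₀ hwx, div_le_iff₀ hwx]
  have hIint : IntegrableOn (fun y => Real.exp (-W x * (L₁ * (y / w x) ^ (-p₁))))
      (Ioc (a * w x) (b * w x)) (μ.map X₂) := by
    refine IntegrableOn.mono_set (t := Icc (a * w x) (b * w x)) ?_ Ioc_subset_Icc_self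
    refine ContinuousOn.integrableOn_Icc fun y hy => ContinuousAt.continuousWithinAt ?_
    have hy0 : 0 < y := (mul_pos ha hwx).trans_le hy.1
    have : ContinuousAt (fun y => (y / w x) ^ (-p₁)) y :=
      ContinuousAt.rpow_const (by fun_prop) (Or.inl (by positivity))
    fun_prop
  obtain ⟨hIl, hIu⟩ := integral_weibull_bounds (ν := μ.map X₂) (L₂ := L₂) (p₂ := p₂) hL₁ hp₁ ha
    (haA.trans hAb).le hwx hWx.le (fun s hs => (htail s hs).1) (fun s hs => (htail s hs).2)
  rw [Real.dist_eq] at hlx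
  rw [hset, heq]
  refine (abs_sub_one_le_of_sandwich hδ0 hδ1 hN0 hg₂x (by positivity) ?_ ?_ hIl hIu hax hlx
    hbx).trans hδε
  · rw [← integral_const_mul, ← integral_const_mul]
    exact setIntegral_mono_on ((hIint.const_mul N).const_mul _) hint measurableSet_Ioc
      fun y hy => (hker y hy).1
  · rw [← integral_const_mul, ← integral_const_mul]
    exact setIntegral_mono_on hint ((hIint.const_mul N).const_mul _) measurableSet_Ioc
      fun y hy => (hker y hy).2

end Inside

/-! ### The constants, and the conclusion -/

/-- The critical equation turns `L₁ p₁ A ^ (-p₁ - 1)` into `L₂ p₂ A ^ (p₂ - 1)`; the identity then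
follows by bringing everything under one square root. -/
theorem laplace_constant_eq {p₁ p₂ L₁ L₂ A : ℝ} (hp₁ : 0 < p₁) (hp₂ : 0 < p₂) (hL₂ : 0 < L₂)
    (hA0 : 0 < A) (hA : L₂ * p₂ * A ^ (p₁ + p₂) = p₁ * L₁) :
    L₁ * p₁ * A ^ (-p₁ - 1) * √(Real.pi / (L₂ * p₂ * (p₁ + p₂) * A ^ (p₂ - 2) / 2)) =
      (2 * Real.pi * p₂ * L₂ / (p₁ + p₂)) ^ (1 / 2 : ℝ) * A ^ (p₂ / 2) := by
  have h1 : L₁ * p₁ * A ^ (-p₁ - 1) = L₂ * p₂ * A ^ (p₂ - 1) := by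
    rw [mul_comm L₁, ← hA, mul_assoc, ← Real.rpow_add hA0]
    congr 2
    ring
  have h2 : A ^ (p₂ / 2) = √(A ^ p₂) := by
    rw [Real.sqrt_eq_rpow, ← Real.rpow_mul hA0.le]
    congr 1
    ring
  have h3 : A ^ (p₂ - 1) * A ^ (p₂ - 1) = A ^ p₂ * A ^ (p₂ - 2) := by
    rw [← Real.rpow_add hA0, ← Real.rpow_add hA0]
    congr 1
    ring
  have h4 : 0 < A ^ (p₂ - 2) := Real.rpow_pos_of_pos hA0 _
  have h5 : 0 < A ^ (p₂ - 1) := Real.rpow_pos_of_pos hA0 _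
  rw [h1, h2, ← Real.sqrt_eq_rpow, ← Real.sqrt_mul (by positivity),
    ← Real.sqrt_mul_self (show 0 ≤ L₂ * p₂ * A ^ (p₂ - 1) by positivity),
    ← Real.sqrt_mul (by positivity)]
  congr 1
  field_simp
  rw [sq, h3]
  ring

/-- The power of `x` collects `q₁` and `p₁ (q₂ - q₁) / (p₁ + p₂)` from `c`, and `p₁ p₂ / (2 (p₁ +
p₂))` from `√W`. -/
theorem product_tail_main_term_eq {p₁ p₂ L₁ L₂ A D q₁ q₂ G₁ G₂ E x : ℝ} (hp₁ : 0 < p₁)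
    (hp₂ : 0 < p₂) (hL₂ : 0 < L₂) (hA0 : 0 < A) (hA : L₂ * p₂ * A ^ (p₁ + p₂) = p₁ * L₁)
    (hx : 0 < x) :
    D * x ^ q₁ * (A * x ^ (p₁ / (p₁ + p₂))) ^ (q₂ - q₁) * G₁ * G₂ *
      (L₁ * p₁ * A ^ (-p₁ - 1) * √(Real.pi / (L₂ * p₂ * (p₁ + p₂) * A ^ (p₂ - 2) / 2)) *
        (√(x ^ (p₁ * p₂ / (p₁ + p₂))) * E)) =
    D * (2 * Real.pi * p₂ * L₂ / (p₁ + p₂)) ^ (1 / 2 : ℝ) * A ^ (p₂ / 2 + q₂ - q₁)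
        * x ^ ((2 * p₂ * q₁ + 2 * p₁ * q₂ + p₁ * p₂) / (2 * (p₁ + p₂))) * G₁ * G₂ * E := by
  have h1 : x ^ ((2 * p₂ * q₁ + 2 * p₁ * q₂ + p₁ * p₂) / (2 * (p₁ + p₂))) =
      x ^ q₁ * (x ^ (p₁ / (p₁ + p₂))) ^ (q₂ - q₁) * √(x ^ (p₁ * p₂ / (p₁ + p₂))) := by
    rw [Real.sqrt_eq_rpow, ← Real.rpow_mul hx.le, ← Real.rpow_mul hx.le, ← Real.rpow_add hx,
      ← Real.rpow_add hx]
    congr 1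
    field_simp
    ring
  rw [laplace_constant_eq hp₁ hp₂ hL₂ hA0 hA, h1, add_sub_assoc, Real.rpow_add hA0,
    Real.mul_rpow hA0.le (Real.rpow_pos_of_pos hx _).le]
  ring

/-- This is the vanishing of the exponent's derivative at `A`. -/
theorem mul_rpow_eq_of_eq_div_rpow {p₁ p₂ L₁ L₂ A : ℝ} (hp₁ : 0 < p₁) (hp₂ : 0 < p₂)
    (hL₁ : 0 < L₁) (hL₂ : 0 < L₂) (hA : A = (p₁ * L₁ / (p₂ * L₂)) ^ (1 / (p₁ + p₂))) :
    L₂ * p₂ * A ^ (p₁ + p₂) = p₁ * L₁ := by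
  rw [hA, ← Real.rpow_mul (by positivity), one_div_mul_cancel (by positivity), Real.rpow_one]
  field_simp

theorem measureReal_mul_tail_eq_add {Ω : Type*} [MeasurableSpace Ω] {μ : Measure Ω}
    [IsProbabilityMeasure μ] {X₁ X₂ : Ω → ℝ} (hX₁ : Measurable X₁) (hX₂ : Measurable X₂)
    (hpos₂ : ∀ᵐ ω ∂μ, 0 < X₂ ω) {x w a b : ℝ} (hw : 0 < w) :
    μ.real {ω | x < X₁ ω * X₂ ω} =
      μ.real {ω | x < X₁ ω * X₂ ω ∧ X₂ ω / w ∈ Ioc a b} +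
      μ.real {ω | x < X₁ ω * X₂ ω ∧ X₂ ω / w ∈ Ioc 0 a ∪ Ioi b} := by
  have hm : MeasurableSet {ω | x < X₁ ω * X₂ ω} := measurableSet_lt measurable_const (hX₁.mul hX₂)
  have hmw : Measurable fun ω => X₂ ω / w := hX₂.div_const w
  have hdis : Disjoint {ω | x < X₁ ω * X₂ ω ∧ X₂ ω / w ∈ Ioc a b}
      {ω | x < X₁ ω * X₂ ω ∧ X₂ ω / w ∈ Ioc 0 a ∪ Ioi b} := by
    rw [Set.disjoint_left]
    rintro ω ⟨-, h1⟩ ⟨-, h2 | h2⟩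
    · exact absurd h1.1 (not_lt.2 h2.2)
    · exact absurd h1.2 (not_le.2 h2)
  rw [← measureReal_union hdis (hm.inter (hmw (measurableSet_Ioc.union measurableSet_Ioi)))]
  refine measureReal_congr ?_
  filter_upwards [hpos₂] with ω hω
  have h0 : 0 < X₂ ω / w := by positivity
  refine propext ⟨fun h => ?_, ?_⟩
  · by_cases h1 : X₂ ω / w ∈ Ioc a b
    · exact Or.inl ⟨h, h1⟩
    · refine Or.inr ⟨h, ?_⟩
      rcases le_or_gt (X₂ ω / w) a with h2 | h2
      · exact Or.inl ⟨h0, h2⟩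
      · exact Or.inr (not_le.1 fun h3 => h1 ⟨h2, h3⟩)
  · rintro (h | h)
    · exact h.1
    · exact h.1

theorem theorem2p1 {Ω : Type*} [MeasurableSpace Ω] (μ : Measure Ω) [IsProbabilityMeasure μ]
    -- the two positive, possibly dependent, risks
    (X₁ X₂ : Ω → ℝ) (hX₁ : Measurable X₁) (hX₂ : Measurable X₂)
    (hpos₁ : ∀ᵐ ω ∂μ, 0 < X₁ ω) (hpos₂ : ∀ᵐ ω ∂μ, 0 < X₂ ω)
    -- their Weibull-type marginal tails
    (p₁ p₂ L₁ L₂ : ℝ) (hp₁ : 0 < p₁) (hp₂ : 0 < p₂) (hL₁ : 0 < L₁) (hL₂ : 0 < L₂)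
    (g₁ g₂ : ℝ → ℝ) (α₁ α₂ : ℝ)
    (hg₁ : IsRegularlyVarying g₁ α₁) (hg₂ : IsRegularlyVarying g₂ α₂)
    (hmon₁ : IsUltimatelyMonotone g₁) (hmon₂ : IsUltimatelyMonotone g₂)
    (htail₁ : HasWeibullTail μ X₁ g₁ L₁ p₁) (htail₂ : HasWeibullTail μ X₂ g₂ L₂ p₂)
    -- the constants of the conclusion
    (A B : ℝ) (hA : A = (p₁ * L₁ / (p₂ * L₂)) ^ (1 / (p₁ + p₂)))
    (hB : B = L₁ * A ^ (-p₁) + L₂ * A ^ p₂)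
    -- the dependence function: `P(X₁ > x/y | X₂ = y) = P(X₁ > x/y) c(x, y)` for all large `x`
    (c : ℝ → ℝ → ℝ) (hc : Measurable (Function.uncurry c))
    (hcpos : ∀ x y : ℝ, 0 < x → 0 < y → 0 < c x y)
    (hcond : ∀ᶠ x : ℝ in atTop, ∀ᵐ y ∂(μ.map X₂),
      (condDistrib X₁ X₂ μ y).real (Ioi (x / y)) = μ.real {ω | x / y < X₁ ω} * c x y)
    (K₁ K₂ β₁ β₂ : ℝ) (hK₁ : 0 < K₁) (hK₂ : 0 < K₂)
    (hbound : ∀ᶠ x : ℝ in atTop, ∀ y : ℝ, 0 < y →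
      K₁ * x ^ β₁ ≤ c x y ∧ c x y ≤ K₂ * x ^ β₂)
    -- `c(x, y) ∼ D x ^ q₁ y ^ (q₂ - q₁)` uniformly in `y ∈ [a₁ w_x, a₂ w_x]`, where
    -- `w_x = x ^ (p₁ / (p₁ + p₂))` and the window contains `z_x = A w_x` in its interior
    (D a₁ a₂ q₁ q₂ : ℝ) (hD : 0 < D) (ha₁ : 0 < a₁) (ha₁A : a₁ < A) (hAa₂ : A < a₂)
    (hunif : ∀ ε : ℝ, 0 < ε → ∀ᶠ x : ℝ in atTop,
      ∀ y ∈ Icc (a₁ * x ^ (p₁ / (p₁ + p₂))) (a₂ * x ^ (p₁ / (p₁ + p₂))),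
        |c x y / (D * x ^ q₁ * y ^ (q₂ - q₁)) - 1| ≤ ε)
    (z : ℝ → ℝ) (hz : ∀ x : ℝ, z x = A * x ^ (p₁ / (p₁ + p₂))) :
    (fun x : ℝ => μ.real {ω | x < X₁ ω * X₂ ω}) ~[atTop] fun x : ℝ =>
      D * (2 * Real.pi * p₂ * L₂ / (p₁ + p₂)) ^ (1 / 2 : ℝ) * A ^ (p₂ / 2 + q₂ - q₁)
        * x ^ ((2 * p₂ * q₁ + 2 * p₁ * q₂ + p₁ * p₂) / (2 * (p₁ + p₂)))
        * g₁ (x / z x) * g₂ (z x) * Real.exp (-B * x ^ (p₁ * p₂ / (p₁ + p₂))) := by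
  have hA0 : 0 < A := by rw [hA]; positivity
  have hAeq := mul_rpow_eq_of_eq_div_rpow hp₁ hp₂ hL₁ hL₂ hA
  have hBeq : B = productExponent L₁ p₁ L₂ p₂ A := hB
  obtain ⟨hF₁pos, hF₁log⟩ := tendsto_log_div_of_isEquivalent hp₁ hg₁.eventually_pos
    (hg₁.tendsto_log_div_rpow hmon₁ hp₁) htail₁
  obtain ⟨hF₂pos, hF₂log⟩ := tendsto_log_div_of_isEquivalent hp₂ hg₂.eventually_pos
    (hg₂.tendsto_log_div_rpow hmon₂ hp₂) htail₂
  set W : ℝ → ℝ := fun x => x ^ (p₁ * p₂ / (p₁ + p₂)) with hWdef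
  set w : ℝ → ℝ := fun x => x ^ (p₁ / (p₁ + p₂)) with hwdef
  set V : ℝ → ℝ := fun x => x ^ (p₂ / (p₁ + p₂)) with hVdef
  have hW : Tendsto W atTop atTop := tendsto_rpow_atTop (by positivity)
  have hw : Tendsto w atTop atTop := tendsto_rpow_atTop (by positivity)
  have hV : Tendsto V atTop atTop := tendsto_rpow_atTop (by positivity)
  have hwW : ∀ᶠ x in atTop, w x ^ p₂ = W x := by
    filter_upwards [eventually_ge_atTop 0] with x hx using rpow_div_add_rpow hx p₂
  have hVW : ∀ᶠ x in atTop, V x ^ p₁ = W x := by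
    filter_upwards [eventually_ge_atTop 0] with x hx
    simp only [hVdef, hWdef]
    rw [← Real.rpow_mul hx]
    congr 1
    ring
  set C : ℝ := D * (2 * Real.pi * p₂ * L₂ / (p₁ + p₂)) ^ (1 / 2 : ℝ) * A ^ (p₂ / 2 + q₂ - q₁)
    with hC
  have hC0 : 0 < C := by positivity
  set e : ℝ := (2 * p₂ * q₁ + 2 * p₁ * q₂ + p₁ * p₂) / (2 * (p₁ + p₂)) with he
  set M : ℝ → ℝ := fun x => C * x ^ e * g₁ (A⁻¹ * V x) * g₂ (A * w x) * Real.exp (-B * W x)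
    with hM
  have hg₁pos : ∀ᶠ x in atTop, 0 < g₁ (A⁻¹ * V x) :=
    (hV.const_mul_atTop (inv_pos.2 hA0)).eventually hg₁.eventually_pos
  have hg₂pos : ∀ᶠ x in atTop, 0 < g₂ (A * w x) :=
    (hw.const_mul_atTop hA0).eventually hg₂.eventually_pos
  have hMpos : ∀ᶠ x in atTop, 0 < M x := by
    filter_upwards [hg₁pos, hg₂pos, eventually_gt_atTop 0] with x h1 h2 hx
    simp only [hM]
    positivity
  -- Only the exponential survives division by `W`, so the main term has rate `-B`.
  have hMlog : Tendsto (fun x => Real.log (M x) / W x) atTop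
      (𝓝 (-productExponent L₁ p₁ L₂ p₂ A)) := by
    have h1 := tendsto_log_comp_div (inv_pos.2 hA0) (hg₁.tendsto_log_div_rpow hmon₁ hp₁) hV hVW
    have h2 := tendsto_log_comp_div hA0 (hg₂.tendsto_log_div_rpow hmon₂ hp₂) hw hwW
    have h3 : Tendsto (fun x : ℝ => Real.log (C * x ^ e) / W x) atTop (𝓝 0) :=
      tendsto_log_const_mul_rpow_div hC0 (by positivity)
    have h4 := ((h3.add h1).add h2).add_const (-B)
    rw [zero_mul, zero_mul, add_zero, add_zero, zero_add, hBeq] at h4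
    refine h4.congr' ?_
    filter_upwards [hg₁pos, hg₂pos, eventually_gt_atTop 0, hW.eventually_gt_atTop 0]
      with x k1 k2 hx hWx
    have hxe := Real.rpow_pos_of_pos hx e
    simp only [hM]
    rw [Real.log_mul (x := C * x ^ e * g₁ (A⁻¹ * V x) * g₂ (A * w x)) (by positivity)
      (by positivity), Real.log_mul (x := C * x ^ e * g₁ (A⁻¹ * V x)) (by positivity) k2.ne',
      Real.log_mul (x := C * x ^ e) (by positivity) k1.ne', Real.log_exp, ← hBeq]
    field_simp
  have hgoal : M =ᶠ[atTop] fun x : ℝ => C * x ^ e * g₁ (x / z x) * g₂ (z x)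
      * Real.exp (-B * x ^ (p₁ * p₂ / (p₁ + p₂))) := by
    filter_upwards [eventually_gt_atTop 0] with x hx
    simp only [hM]
    rw [hz x, div_mul_rpow_div_add hx hp₁ hp₂]
  refine Asymptotics.IsEquivalent.congr_right ?_ hgoal
  rw [Asymptotics.isEquivalent_iff_tendsto_one (hMpos.mono fun x hx => hx.ne'),
    Metric.tendsto_nhds]
  intro ε hε
  -- The window depends on `ε`, which is harmless: the outside estimate holds for every fixed window
  -- around `A`.
  obtain ⟨a, b, ha, haA, hAb, hin⟩ := exists_window_tail hX₁ hX₂ hp₁ hp₂ hL₁ hL₂ hg₁ hg₂ hmon₁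
    hmon₂ htail₁ htail₂ hA0 hAeq hcond hD ha₁A hAa₂ hunif (show 0 < ε / 3 by positivity)
  have hout := tendsto_outside_window hX₁ hX₂ hp₁ hp₂ hL₁ hL₂ hF₁pos hF₂pos hF₁log hF₂log hA0
    hAeq hK₂ hcond (hbound.mono fun x h y hy => (h y hy).2) hMpos hMlog haA hAb
  filter_upwards [hin, hout.eventually_lt_const (show 0 < ε / 3 by positivity), hMpos,
    eventually_gt_atTop 0, hw.eventually_gt_atTop 0] with x h1 h2 hMx hx hwx
  rw [product_tail_main_term_eq hp₁ hp₂ hL₂ hA0 hAeq hx, ← hBeq,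
    show -x ^ (p₁ * p₂ / (p₁ + p₂)) * B = -B * W x by simp only [hWdef]; ring] at h1
  rw [Real.dist_eq, Pi.div_apply,
    measureReal_mul_tail_eq_add hX₁ hX₂ hpos₂ hwx (a := a) (b := b), add_div, add_sub_right_comm]
  refine (abs_add_le _ _).trans_lt ?_
  rw [abs_of_nonneg (div_nonneg measureReal_nonneg hMx.le)]
  have h3 := add_lt_add_of_le_of_lt h1 h2
  refine h3.trans ?_
  linarith
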